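/- Let $n\ge 3$, let $e_1,\dots,e_n$ be the standard basis of $\mathbb{R}^n$, $\sigma_m = 2\pi^{(m+1)/2}/\Gamma((m+1)/2)$ the area of $S^m$, $\Xi$ the set of sections $\xi=S^{n-1}\cap W$ with hyperplanes $W$ through the origin, $\xi_o=S^{n-1}\cap e_n^{\perp}$, and $K\cong SO(n-1)$ the stabilizer of $e_n$ in $SO(n)$, with normalized Haar measure $d\rho$. For $x\in S^{n-1}$ let $r_x\in SO(n)$ be a rotation with $r_xe_n=x$. Fix $k\ne n$ and let $g_{k,n}(\theta)$ be the rotation in the $e_ke_n$-plane with matrix $\begin{pmatrix}\sin\theta&\cos\theta\\-\cos\theta&\sin\theta\end{pmatrix}$. Define $$(Mf)(\xi)=\int_\xi f(y)\,dy,\qquad (M_\theta^*\varphi)(x)=\int_K\varphi\bigl(r_x\,\rho\, g_{k,n}(\theta)^{-1}\xi_o\bigr)\,d\rho ,$$ $$(M^tf)(x)=\frac{(1-t^2)^{(2-n)/2}}{\sigma_{n-2}}\int_{\{\sigma\in S^{n-1}:\ \sigma\cdot x=t\}}f(\sigma)\,d\sigma,\qquad \widetilde{f_x}(\tau)=\frac{1}{\sqrt\tau}\,(M^{\sqrt\tau}f)(x)\quad(0<\tau<1),$$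 where $dy$ and $d\sigma$ are the (unnormalized) Lebesgue measures on these $(n-2)$-dimensional spheres. For $\alpha>0$ let $$(I_{0+}^\alpha\psi)(t)=\frac1{\Gamma(\alpha)}\int_0^t\psi(\tau)(t-\tau)^{\alpha-1}\,d\tau ,$$ acting on functions $\psi$ on $(0,1)$ that are integrable on $(0,a)$ for every $a<1$, and let $D_{0+}^\alpha=(I_{0+}^\alpha)^{-1}$ on the range of $I_{0+}^{\alpha}$ (functions are identified when they agree almost everywhere). Let $f\in L^1(S^{n-1})$ be even. Then for every $x\in S^{n-1}$ the function $t\mapsto t^{(n-3)/2}\,(M^*_{\arccos\sqrt t}Mf)(x)$ on $(0,1)$ lies in the range of $I_{0+}^{(n-2)/2}$, and $$\widetilde{f_x}(t)=\bigl(2\pi^{(n-2)/2}\bigr)^{-1}D_{0+}^{(n-2)/2}\Bigl((\cdot)^{(n-3)/2}\bigl(M^*_{\arccos\sqrt{\cdot}}Mf\bigr)(x)\Bigr)(t)\qquad\text{for almost every }t\in(0,1).$$ Moreover, for every $t\in(0,1)$ the function $x\mapsto\sqrt t\,\widetilde{f_x}(t)$ is in $L^1(S^{n-1})$, and $$\lim_{t\to1^-}\sqrt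 t\,\widetilde{f_x}(t)=f(x)$$ in the norm of $L^1(S^{n-1})$ (as functions of $x$). If $f$ is continuous, the limit also holds uniformly in $x\in S^{n-1}$. -/

import Mathlib

open MeasureTheory Filter Topology Set Metric
open scoped Matrix

noncomputable section

namespace MinkowskiFunk

/-! ### Spheres and their Lebesgue measures -/

/-- Euclidean space `ℝⁿ`. -/
abbrev Euc (n : ℕ) : Type := EuclideanSpace ℝ (Fin n)

/-- The unit sphere of a normed space; `UnitSphere (Euc n)` is `S^{n-1}`. -/
abbrev UnitSphere (V : Type*) [NormedAddCommGroup V] : Type _ := sphere (0 : V) 1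

/-- The (unnormalized) Lebesgue surface measure on the unit sphere of a finite-dimensional
Euclidean space `V`, induced by the Lebesgue measure of `V`. -/
def sphereMeasure (V : Type*) [NormedAddCommGroup V] [InnerProductSpace ℝ V]
    [FiniteDimensional ℝ V] [MeasurableSpace V] [BorelSpace V] : Measure (UnitSphere V) :=
  (volume : Measure V).toSphere

/-- The surface area `2 π^{(m+1)/2} / Γ((m+1)/2)` of the unit sphere `S^m ⊂ ℝ^{m+1}`. -/
def sphereArea (m : ℕ) : ℝ :=
  2 * Real.pi ^ (((m : ℝ) + 1) / 2) / Real.Gamma (((m : ℝ) + 1) / 2)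

/-! ### Averages over the slices `S_{θ,t} = {σ ∈ S^{n-1} : σ ⬝ θ = t}` -/

/-- The similarity `u ↦ t θ + √(1 - t²) u` of the unit sphere of the hyperplane `θ^⊥` onto the
slice `S_{θ,t}`, for `t ∈ (-1, 1)` (the value for `t² > 1` is irrelevant). -/
def sliceMap {n : ℕ} (θ : UnitSphere (Euc n)) (t : ℝ)
    (u : UnitSphere (Submodule.span ℝ {(θ : Euc n)})ᗮ) : UnitSphere (Euc n) :=
  if h : t ^ 2 ≤ 1 then
    ⟨t • (θ : Euc n) + √(1 - t ^ 2) • ((u : (Submodule.span ℝ {(θ : Euc n)})ᗮ) : Euc n), by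
      have h1 : ‖(θ : Euc n)‖ = 1 := norm_eq_of_mem_sphere θ
      have h2 : ‖((u : (Submodule.span ℝ {(θ : Euc n)})ᗮ) : Euc n)‖ = 1 :=
        norm_eq_of_mem_sphere u
      have h3 : inner ℝ (θ : Euc n) ((u : (Submodule.span ℝ {(θ : Euc n)})ᗮ) : Euc n) = 0 :=
        Submodule.mem_orthogonal_singleton_iff_inner_right.1 u.1.2
      have h4 : √(1 - t ^ 2) ^ 2 = 1 - t ^ 2 := Real.sq_sqrt (by linarith)
      rw [mem_sphere_zero_iff_norm, ← sq_eq_sq₀ (norm_nonneg _) zero_le_one,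
        norm_add_sq_real, norm_smul, norm_smul, h1, h2, inner_smul_left, inner_smul_right, h3]
      simp only [mul_one, mul_zero, add_zero, Real.norm_eq_abs, sq_abs, h4]
      ring⟩
  else θ

/-- The Lebesgue measure on the slice `S_{θ,t}`, an `(n-2)`-dimensional sphere of radius
`√(1 - t²)`: the image of the Lebesgue measure on the unit sphere of `θ^⊥`, scaled by the
`(n-2)`-th power of the radius. -/
def sliceMeasure {n : ℕ} (θ : UnitSphere (Euc n)) (t : ℝ) : Measure (UnitSphere (Euc n)) :=
  ENNReal.ofReal ((1 - t ^ 2) ^ (((n : ℝ) - 2) / 2)) •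
    Measure.map (sliceMap θ t) (sphereMeasure (Submodule.span ℝ {(θ : Euc n)})ᗮ)

/-- The average `(M^t f)(θ) = c_n ∫_{S_{θ,t}} f(σ) d_θσ`, with the normalizing factor
`c_n = (1 - t²)^{(2-n)/2} / σ_{n-2}`. -/
def sliceMean {n : ℕ} {𝕜 : Type*} [RCLike 𝕜] (t : ℝ) (f : UnitSphere (Euc n) → 𝕜)
    (θ : UnitSphere (Euc n)) : 𝕜 :=
  ((1 - t ^ 2) ^ ((2 - (n : ℝ)) / 2) / sphereArea (n - 2)) • ∫ σ, f σ ∂(sliceMeasure θ t)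

/-- The function `f̃ₓ(τ) = τ^{-1/2} (M^{√τ} f)(x)`. -/
def tildeFun {n : ℕ} {𝕜 : Type*} [RCLike 𝕜] (f : UnitSphere (Euc n) → 𝕜)
    (x : UnitSphere (Euc n)) (τ : ℝ) : 𝕜 :=
  (1 / √τ) • sliceMean (√τ) f x

/-! ### Geodesics and the Minkowski-Funk transform -/

/-- The set `Ξ` of `(n-2)`-geodesics `ξ = S^{n-1} ∩ W`, each represented by its hyperplane `W`
through the origin. -/
abbrev Geodesic (n : ℕ) : Type :=
  {W : Submodule ℝ (Euc n) // Module.finrank ℝ W = n - 1}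

/-- A point of the geodesic `S^{n-1} ∩ W`, as a point of `S^{n-1}`. -/
def Geodesic.point {n : ℕ} (ξ : Geodesic n) (u : UnitSphere ξ.1) : UnitSphere (Euc n) :=
  ⟨((u : ξ.1) : Euc n), mem_sphere_zero_iff_norm.2 (norm_eq_of_mem_sphere u)⟩

/-- The Minkowski-Funk transform `(Mf)(ξ) = ∫_ξ f(x) dx`, where `dx` is the Lebesgue measure on
the unit `(n-2)`-sphere `ξ`, of total mass `σ_{n-2}`. -/
def funk {n : ℕ} {𝕜 : Type*} [RCLike 𝕜] (f : UnitSphere (Euc n) → 𝕜) (ξ : Geodesic n) : 𝕜 :=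
  ∫ u, f (ξ.point u) ∂(sphereMeasure ξ.1)

/-! ### The rotation group `SO(n)` and its action -/

/-- `G = SO(n)`. -/
abbrev SO (n : ℕ) : Type := Matrix.specialOrthogonalGroup (Fin n) ℝ

theorem SO.mem_iff {n : ℕ} {A : Matrix (Fin n) (Fin n) ℝ} :
    A ∈ Matrix.specialOrthogonalGroup (Fin n) ℝ ↔ Aᵀ * A = 1 ∧ A.det = 1 := by
  rw [Matrix.mem_specialOrthogonalGroup_iff, Matrix.mem_orthogonalGroup_iff']

theorem SO.coe_inv {n : ℕ} (A : SO n) :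
    ((A⁻¹ : SO n) : Matrix (Fin n) (Fin n) ℝ) = (A : Matrix (Fin n) (Fin n) ℝ)ᵀ := by
  ext i j
  rfl

/-- A rotation as a linear automorphism `x ↦ A x` of `ℝⁿ`. -/
def SO.toLinearEquiv {n : ℕ} (A : SO n) : Euc n ≃ₗ[ℝ] Euc n :=
  LinearEquiv.ofLinearMap (Matrix.toEuclideanLin (A : Matrix (Fin n) (Fin n) ℝ))
    (Matrix.toEuclideanLin ((A⁻¹ : SO n) : Matrix (Fin n) (Fin n) ℝ))
    (by
      ext1 x
      have h : (A : Matrix (Fin n) (Fin n) ℝ) * ((A⁻¹ : SO n) : Matrix (Fin n) (Fin n) ℝ) = 1 :=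
        congrArg Subtype.val (mul_inv_cancel A)
      simp [Matrix.toLpLin_apply, Matrix.mulVec_mulVec, h])
    (by
      ext1 x
      have h : ((A⁻¹ : SO n) : Matrix (Fin n) (Fin n) ℝ) * (A : Matrix (Fin n) (Fin n) ℝ) = 1 :=
        congrArg Subtype.val (inv_mul_cancel A)
      simp [Matrix.toLpLin_apply, Matrix.mulVec_mulVec, h])

/-- The action of `SO(n)` on the geodesics. -/
def Geodesic.rotate {n : ℕ} (A : SO n) (ξ : Geodesic n) : Geodesic n :=
  ⟨ξ.1.map (A.toLinearEquiv : Euc n →ₗ[ℝ] Euc n), by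
    rw [LinearEquiv.finrank_map_eq]
    exact ξ.2⟩

instance SO.instContinuousInv (n : ℕ) : ContinuousInv (SO n) where
  continuous_inv := by
    refine Continuous.subtype_mk (f := fun A : SO n => (A : Matrix (Fin n) (Fin n) ℝ)ᵀ) ?_ _
    exact continuous_subtype_val.matrix_transpose

instance SO.instIsTopologicalGroup (n : ℕ) : IsTopologicalGroup (SO n) where

instance SO.instCompactSpace (n : ℕ) : CompactSpace (SO n) := by
  refine isCompact_iff_compactSpace.1 ?_
  have hc : IsCompact {A : Matrix (Fin n) (Fin n) ℝ | ∀ i j, A i j ∈ Icc (-1 : ℝ) 1} := by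
    have := isCompact_univ_pi (X := fun _ : Fin n => Fin n → ℝ)
      (s := fun _ => {v : Fin n → ℝ | ∀ j, v j ∈ Icc (-1 : ℝ) 1}) (fun _ => by
        have := isCompact_univ_pi (X := fun _ : Fin n => ℝ)
          (s := fun _ => Icc (-1 : ℝ) 1) (fun _ => isCompact_Icc)
        simpa [Set.pi] using this)
    have he : {A : Matrix (Fin n) (Fin n) ℝ | ∀ i j, A i j ∈ Icc (-1 : ℝ) 1} =
        (univ.pi fun _ : Fin n => {v : Fin n → ℝ | ∀ j, v j ∈ Icc (-1 : ℝ) 1}) := by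
      apply Set.ext
      intro A
      exact ⟨fun h i _ => h i, fun h i => h i (mem_univ i)⟩
    rw [he]
    exact this
  refine hc.of_isClosed_subset ?_ ?_
  · have h : (Matrix.specialOrthogonalGroup (Fin n) ℝ : Set (Matrix (Fin n) (Fin n) ℝ)) =
        {A | Aᵀ * A = 1} ∩ {A | A.det = 1} := by
      ext A
      exact SO.mem_iff
    rw [h]
    exact (isClosed_eq (continuous_id.matrix_transpose.mul continuous_id)
      continuous_const).inter (isClosed_eq continuous_id.matrix_det continuous_const)
  · intro A hA i j
    have h := congrFun (congrFun (SO.mem_iff.1 hA).1 j) j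
    rw [Matrix.mul_apply, Matrix.one_apply_eq] at h
    have h2 : A i j * A i j ≤ 1 := by
      rw [← h]
      exact Finset.single_le_sum (f := fun l => Aᵀ j l * A l j)
        (fun l _ => mul_self_nonneg (A l j)) (Finset.mem_univ i)
    exact ⟨by nlinarith, by nlinarith⟩

/-- The index of the last basis vector `e_n`. -/
def lastIdx (n : ℕ) [Fact (3 ≤ n)] : Fin n :=
  ⟨n - 1, by have := (Fact.out : 3 ≤ n); omega⟩

/-- The last basis vector `e_n`, as a point of `S^{n-1}`. -/
def eLast (n : ℕ) [Fact (3 ≤ n)] : UnitSphere (Euc n) :=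
  ⟨EuclideanSpace.single (lastIdx n) 1, by simp⟩

/-- `K = SO(n-1)`, the stabilizer of `e_n` in `SO(n)`. -/
def stabK (n : ℕ) [Fact (3 ≤ n)] : Subgroup (SO n) where
  carrier := {A | A.toLinearEquiv (eLast n) = eLast n}
  one_mem' := by
    change Matrix.toEuclideanLin (1 : Matrix (Fin n) (Fin n) ℝ) _ = _
    simp
  mul_mem' := by
    intro A B hA hB
    have h : (A * B).toLinearEquiv (eLast n) =
        A.toLinearEquiv (B.toLinearEquiv (eLast n)) := by
      change Matrix.toEuclideanLin (A.1 * B.1) _ =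
        Matrix.toEuclideanLin A.1 (Matrix.toEuclideanLin B.1 _)
      simp [Matrix.toLpLin_apply, Matrix.mulVec_mulVec]
    rw [mem_ofPred_eq] at hA hB ⊢
    rw [h, hB, hA]
  inv_mem' := by
    intro A hA
    rw [mem_ofPred_eq] at hA ⊢
    exact (LinearEquiv.symm_apply_eq A.toLinearEquiv).2 hA.symm

instance stabK.instCompactSpace (n : ℕ) [Fact (3 ≤ n)] : CompactSpace (stabK n) := by
  refine isCompact_iff_compactSpace.1 (IsClosed.isCompact ?_)
  have h : Continuous fun A : SO n => A.toLinearEquiv (eLast n) := by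
    change Continuous fun A : SO n => Matrix.toEuclideanLin A.1 _
    simp only [Matrix.toLpLin_apply]
    exact (PiLp.continuous_toLp 2 _).comp
      (continuous_subtype_val.matrix_mulVec continuous_const)
  exact isClosed_eq h continuous_const

instance stabK.instMeasurableSpace (n : ℕ) [Fact (3 ≤ n)] : MeasurableSpace (stabK n) :=
  borel _

instance stabK.instBorelSpace (n : ℕ) [Fact (3 ≤ n)] : BorelSpace (stabK n) := ⟨rfl⟩

/-- The Haar measure `dρ` on `K`, normalized by `∫_K dρ = 1`. -/
def haarK (n : ℕ) [Fact (3 ≤ n)] : Measure (stabK n) := Measure.haarMeasure ⊤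

/-- The matrix that acts in the `e_k e_l`-plane by the block `(a, b; -b, a)`, and as the identity
on the orthogonal complement of that plane. -/
def planeMatrix {n : ℕ} (k l : Fin n) (a b : ℝ) : Matrix (Fin n) (Fin n) ℝ :=
  Matrix.of fun i j =>
    if i = k then (if j = k then a else if j = l then b else 0)
    else if i = l then (if j = k then -b else if j = l then a else 0)
    else if i = j then 1 else 0

theorem planeMatrix_mul {n : ℕ} {k l : Fin n} (h : k ≠ l) (a b c d : ℝ) :
    planeMatrix k l a b * planeMatrix k l c d =
      planeMatrix k l (a * c - b * d) (a * d + b * c) := by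
  have key : ∀ (p q : ℝ) (F : Fin n → ℝ),
      ∑ m, (if m = k then p else if m = l then q else 0) * F m = p * F k + q * F l := by
    intro p q F
    have : ∀ m, (if m = k then p else if m = l then q else 0) * F m =
        (if m = k then p * F m else 0) + (if m = l then q * F m else 0) := by
      intro m
      by_cases h1 : m = k
      · have : m ≠ l := h1 ▸ h
        simp [h1, h]
      · simp [h1]
    simp [this, Finset.sum_add_distrib]
  ext i j
  rw [Matrix.mul_apply]
  by_cases h1 : i = k
  · subst h1
    simp only [planeMatrix, Matrix.of_apply, if_true, key, h.symm, if_false]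
    split_ifs <;> ring
  · by_cases h2 : i = l
    · subst h2
      simp only [planeMatrix, Matrix.of_apply, if_true, key, h.symm, if_false]
      split_ifs <;> ring
    · have h3 : ∀ m, planeMatrix k l a b i m * planeMatrix k l c d m j =
          if i = m then planeMatrix k l c d m j else 0 := by
        intro m
        simp only [planeMatrix, Matrix.of_apply, h1, h2, if_false]
        split_ifs <;> simp
      rw [Finset.sum_congr rfl fun m _ => h3 m]
      simp [planeMatrix, h1, h2]

theorem planeMatrix_transpose {n : ℕ} {k l : Fin n} (h : k ≠ l) (a b : ℝ) :
    (planeMatrix k l a b)ᵀ = planeMatrix k l a (-b) := by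
  ext i j
  simp only [planeMatrix, Matrix.transpose_apply, Matrix.of_apply]
  by_cases hi : i = k <;> by_cases hj : j = k <;> by_cases hi' : i = l <;>
    by_cases hj' : j = l <;> grind

theorem planeMatrix_one_zero {n : ℕ} {k l : Fin n} (h : k ≠ l) :
    planeMatrix k l 1 0 = 1 := by
  ext i j
  simp only [planeMatrix, Matrix.one_apply, Matrix.of_apply]
  split_ifs <;> simp_all

theorem planeMatrix_orthogonal {n : ℕ} {k l : Fin n} (h : k ≠ l) {a b : ℝ}
    (hab : a ^ 2 + b ^ 2 = 1) : (planeMatrix k l a b)ᵀ * planeMatrix k l a b = 1 := by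
  rw [planeMatrix_transpose h, planeMatrix_mul h, ← planeMatrix_one_zero h]
  congr 1
  · linarith
  · ring

theorem planeMatrix_mem {n : ℕ} {k l : Fin n} (h : k ≠ l) (θ : ℝ) :
    planeMatrix k l (Real.sin θ) (Real.cos θ) ∈ Matrix.specialOrthogonalGroup (Fin n) ℝ := by
  rw [SO.mem_iff]
  refine ⟨planeMatrix_orthogonal h (Real.sin_sq_add_cos_sq θ), ?_⟩
  set φ : ℝ := (Real.pi / 2 - θ) / 2 with hφ
  have h2 : Real.pi / 2 - θ = 2 * φ := by rw [hφ]; ring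
  have hs : planeMatrix k l (Real.sin θ) (Real.cos θ) =
      planeMatrix k l (Real.cos φ) (Real.sin φ) * planeMatrix k l (Real.cos φ) (Real.sin φ) := by
    rw [planeMatrix_mul h, ← Real.cos_pi_div_two_sub θ, ← Real.sin_pi_div_two_sub θ, h2,
      Real.cos_two_mul', Real.sin_two_mul]
    congr 1 <;> ring
  have hd := congrArg Matrix.det (planeMatrix_orthogonal h (Real.cos_sq_add_sin_sq φ))
  rw [Matrix.det_mul, Matrix.det_transpose, Matrix.det_one] at hd
  rw [hs, Matrix.det_mul, hd]

/-- For `k ≠ n`, the rotation `g_{k,n}(θ)` in the `e_k e_n`-plane with the matrix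
`(sin θ, cos θ; -cos θ, sin θ)`. -/
def planeRotation {n : ℕ} [Fact (3 ≤ n)] (k : {k : Fin n // k ≠ lastIdx n}) (θ : ℝ) : SO n :=
  ⟨planeMatrix k.1 (lastIdx n) (Real.sin θ) (Real.cos θ), planeMatrix_mem k.2 θ⟩

theorem exists_rotation {n : ℕ} [Fact (3 ≤ n)] (x : UnitSphere (Euc n)) :
    ∃ A : SO n, A.toLinearEquiv (eLast n) = x := by
  have hx : ‖(x : Euc n)‖ = 1 := norm_eq_of_mem_sphere x
  obtain ⟨b, hb⟩ := Orthonormal.exists_orthonormalBasis_extension_of_card_eq (𝕜 := ℝ)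
    (E := Euc n) (ι := Fin n) (v := fun _ => (x : Euc n)) (s := {lastIdx n}) (by simp) (by
      constructor
      · intro i
        exact hx
      · intro i j hij
        exact absurd (Subsingleton.elim i j) hij)
  have hbl : b (lastIdx n) = x := hb _ rfl
  set B : Matrix (Fin n) (Fin n) ℝ := Matrix.of fun i j => b j i with hB
  have hBB : Bᵀ * B = 1 := by
    ext i j
    have h := orthonormal_iff_ite.1 b.orthonormal j i
    rw [PiLp.inner_apply] at h
    simpa [Matrix.mul_apply, hB, Matrix.one_apply, eq_comm] using h
  have hdet : B.det * B.det = 1 := by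
    have hd := congrArg Matrix.det hBB
    rwa [Matrix.det_mul, Matrix.det_transpose, Matrix.det_one] at hd
  set k : Fin n := ⟨0, by have := (Fact.out : 3 ≤ n); omega⟩ with hk
  have hkl : lastIdx n ≠ k := by
    have := (Fact.out : 3 ≤ n)
    simp only [lastIdx, hk, ne_eq, Fin.mk.injEq]
    omega
  set D : Matrix (Fin n) (Fin n) ℝ := Matrix.diagonal (Function.update 1 k B.det) with hD
  have hDdet : D.det = B.det := by
    rw [hD, Matrix.det_diagonal, Finset.prod_update_of_mem (Finset.mem_univ k)]
    simp
  refine ⟨⟨B * D, SO.mem_iff.2 ⟨?_, ?_⟩⟩, ?_⟩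
  · rw [Matrix.transpose_mul, Matrix.mul_assoc, ← Matrix.mul_assoc Bᵀ, hBB, Matrix.one_mul, hD,
      Matrix.diagonal_transpose, Matrix.diagonal_mul_diagonal, ← Matrix.diagonal_one]
    congr 1
    ext i
    by_cases hi : i = k
    · subst hi
      simpa using hdet
    · simp [hi]
  · rw [Matrix.det_mul, hDdet, hdet]
  · change Matrix.toEuclideanLin (B * D) (EuclideanSpace.single (lastIdx n) 1) = x
    ext i
    rw [← hbl]
    simp [Matrix.toLpLin_apply, hB, hD, Function.update_of_ne hkl]

/-- A rotation `r_x` with `r_x e_n = x`. -/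
def rotationTo {n : ℕ} [Fact (3 ≤ n)] (x : UnitSphere (Euc n)) : SO n :=
  (exists_rotation x).choose

theorem rotationTo_spec {n : ℕ} [Fact (3 ≤ n)] (x : UnitSphere (Euc n)) :
    (rotationTo x).toLinearEquiv (eLast n) = x :=
  (exists_rotation x).choose_spec

/-! ### The generalized dual Minkowski-Funk transform -/

/-- The base geodesic `ξ_o = S^{n-1} ∩ e_n^⊥`. -/
def baseGeodesic (n : ℕ) [Fact (3 ≤ n)] : Geodesic n :=
  ⟨(Submodule.span ℝ {(eLast n : Euc n)})ᗮ, by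
    have h3 := (Fact.out : 3 ≤ n)
    have : Fact (Module.finrank ℝ (Euc n) = (n - 1) + 1) := ⟨by simp; omega⟩
    exact Submodule.finrank_orthogonal_span_singleton (n := n - 1)
      (ne_zero_of_mem_unit_sphere (eLast n))⟩

/-- The generalized dual transform
`(M_θ^* φ)(x) = ∫_K φ(r_x ρ g_{k,n}(θ)⁻¹ ξ_o) dρ`. -/
def dualFunk {n : ℕ} [Fact (3 ≤ n)] {𝕜 : Type*} [RCLike 𝕜] (k : {k : Fin n // k ≠ lastIdx n})
    (θ : ℝ) (φ : Geodesic n → 𝕜) (x : UnitSphere (Euc n)) : 𝕜 :=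
  ∫ ρ : stabK n,
    φ ((baseGeodesic n).rotate (rotationTo x * (ρ : SO n) * (planeRotation k θ)⁻¹)) ∂(haarK n)

/-! ### Riemann-Liouville fractional integrals and derivatives on `(0, b)` -/

/-- The Riemann-Liouville fractional integral
`(I_{0+}^α ψ)(t) = Γ(α)⁻¹ ∫_0^t ψ(τ) (t - τ)^{α-1} dτ`. -/
def rlIntegral {𝕜 : Type*} [RCLike 𝕜] (α : ℝ) (ψ : ℝ → 𝕜) (t : ℝ) : 𝕜 :=
  (1 / Real.Gamma α) • ∫ τ in (0 : ℝ)..t, (t - τ) ^ (α - 1) • ψ τ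

/-- `ψ`, integrable on `(0, a)` for every `a < b`, solves `I_{0+}^α ψ = g` a.e. on `(0, b)`. -/
def IsRLPreimage {𝕜 : Type*} [RCLike 𝕜] (α b : ℝ) (g ψ : ℝ → 𝕜) : Prop :=
  (∀ a ∈ Ioo 0 b, IntegrableOn ψ (Ioo 0 a)) ∧
    ∀ᵐ t ∂(volume.restrict (Ioo 0 b)), rlIntegral α ψ t = g t

open Classical in
/-- The Riemann-Liouville fractional derivative `D_{0+}^α = (I_{0+}^α)⁻¹` on `(0, b)`, a function
defined up to a null set, for `g` in the range of `I_{0+}^α`. -/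
def rlDeriv {𝕜 : Type*} [RCLike 𝕜] (α b : ℝ) (g : ℝ → 𝕜) : ℝ → 𝕜 :=
  if h : ∃ ψ, IsRLPreimage α b g ψ then h.choose else 0

/-- The function `t ↦ t^{(n-3)/2} (M_{arccos √t}^* M f)(x)`. -/
def dualFunkProfile {n : ℕ} [Fact (3 ≤ n)] {𝕜 : Type*} [RCLike 𝕜]
    (k : {k : Fin n // k ≠ lastIdx n}) (f : UnitSphere (Euc n) → 𝕜) (x : UnitSphere (Euc n))
    (t : ℝ) : 𝕜 :=
  (t ^ (((n : ℝ) - 3) / 2)) • dualFunk k (Real.arccos (√t)) (funk f) x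

end MinkowskiFunk

end

noncomputable section

namespace MinkowskiFunk

open scoped ENNReal NNReal

/-! ### Integration over unit spheres -/

section Spheres

variable {V : Type*} [NormedAddCommGroup V] [InnerProductSpace ℝ V] [FiniteDimensional ℝ V]
  [MeasurableSpace V] [BorelSpace V]

/-! The composition $M_\theta^*M$ averages slice means. For a unit vector $u\in e_n^\perp$, the
point $g_{k,n}(\theta)^{-1}u$ has height $\cos\theta\,u_k$ over the equator
(`inner_rot_planeRotation_inv`). Since $K$ is transitive on the unit sphere of $e_n^\perp$,
averaging $f(r_x\rho y)$ over $\rho\in K$ gives the mean of $f$ over the slice around $x$ at the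
height of $y$ (`map_haarK`). Fubini and the law of one coordinate on a sphere
(`lintegral_inner_sphere`) then give
$$(M_\theta^*Mf)(x)=\sigma_{n-3}\int_{-1}^1(1-s^2)^{(n-4)/2}(M^{s\cos\theta}f)(x)\,ds .$$ Evenness
of $f$ folds this onto $(0,1)$. With $\cos\theta=\sqrt t$, the substitution $\tau=ts^2$ turns it
into $t^{-(n-3)/2}\,2\pi^\alpha\,(I_{0+}^{\alpha}\widetilde{f_x})(t)$, where $\alpha=(n-2)/2$
(`dualFunkProfile_ae_eq`).

To invert, $I_{0+}^\alpha$ must be injective on locally integrable functions. As $2\alpha=n-2$ is a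
positive integer, a second application of $I_{0+}^\alpha$ yields an ordinary iterated integral, and
repeated Lebesgue differentiation finishes (`ae_eq_zero_of_ae_rl_eq_zero`).

Every $x$ is allowed although $f$ is only integrable. By slicing the sphere around $x$, a null set
is null in almost every slice around that $x$, and it is also null for the measure underlying
$M_\theta^*M$ whenever $0<\cos\theta<1$. So $f$ may be replaced by a Borel representative that is
even everywhere, and finiteness of all integrals comes from the Tonelli versions of the same
formulas.

For the limit, the slice at height $\sqrt t$ shrinks to $x$ uniformly in $x$, which settles
continuous $f$ by uniform continuity. Slice means preserve the integral over the sphere of a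
nonnegative function (`lintegral_lintegral_sliceProb`), hence contract $L^1$, and density of
continuous functions gives the $L^1$ limit. -/

instance : IsFiniteMeasure (sphereMeasure V) := by
  unfold sphereMeasure; infer_instance

theorem sphereArea_pos (m : ℕ) : 0 < sphereArea m := by
  have : 0 < Real.Gamma (((m : ℝ) + 1) / 2) := Real.Gamma_pos_of_pos (by positivity)
  unfold sphereArea
  positivity

theorem sphereMeasure_univ {m : ℕ} (hm : Module.finrank ℝ V = m + 1) :
    sphereMeasure V univ = ENNReal.ofReal (sphereArea m) := by
  have : Nontrivial V := Module.nontrivial_of_finrank_pos (R := ℝ) (by omega)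
  have hpos : (0 : ℝ) < ((m : ℝ) + 1) / 2 := by positivity
  rw [sphereMeasure, Measure.toSphere_apply_univ, InnerProductSpace.volume_ball, hm,
    ENNReal.ofReal_one, one_pow, one_mul, ← ENNReal.ofReal_natCast,
    ← ENNReal.ofReal_mul (by positivity)]
  congr 1
  push_cast
  rw [Real.Gamma_add_one hpos.ne', sphereArea, Real.sqrt_eq_rpow, ← Real.rpow_natCast,
    ← Real.rpow_mul Real.pi_pos.le]
  have := (Real.Gamma_pos_of_pos hpos).ne'
  push_cast
  rw [show 1 / 2 * ((m : ℝ) + 1) = ((m : ℝ) + 1) / 2 by ring]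
  field_simp

theorem lintegral_eq_lintegral_sphere [Nontrivial V] {F : V → ℝ≥0∞} (hF : Measurable F) :
    ∫⁻ y, F y = ∫⁻ u : UnitSphere V, ∫⁻ r in Ioi (0 : ℝ),
      ENNReal.ofReal (r ^ (Module.finrank ℝ V - 1)) * F (r • (u : V)) ∂volume
        ∂(sphereMeasure V) := by
  have h1 : ∫⁻ y, F y = ∫⁻ y : ({0}ᶜ : Set V), F y ∂((volume : Measure V).comap (↑)) := by
    rw [lintegral_subtype_comap (measurableSet_singleton _).compl, restrict_compl_singleton]
  have h2 := (volume : Measure V).measurePreserving_homeomorphUnitSphereProd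
  have h3 : ∫⁻ y : ({0}ᶜ : Set V), F y ∂((volume : Measure V).comap (↑)) =
      ∫⁻ p : UnitSphere V × Ioi (0 : ℝ), F ((p.2 : ℝ) • (p.1 : V))
        ∂((volume : Measure V).toSphere.prod
          (Measure.volumeIoiPow (Module.finrank ℝ V - 1))) := by
    rw [← h2.lintegral_comp_emb (Homeomorph.measurableEmbedding _)]
    refine lintegral_congr fun y => ?_
    have : (‖(y : V)‖ : ℝ) ≠ 0 := norm_ne_zero_iff.2 y.2
    simp [smul_smul, this]
  rw [h1, h3, lintegral_prod _ (by fun_prop)]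
  refine lintegral_congr fun u => ?_
  rw [Measure.volumeIoiPow, lintegral_withDensity_eq_lintegral_mul _ (by fun_prop)
    (by fun_prop)]
  exact lintegral_subtype_comap measurableSet_Ioi
    (fun r : ℝ => ENNReal.ofReal (r ^ (Module.finrank ℝ V - 1)) * F (r • (u : V)))

/-- Splitting off the direction of a unit vector. -/
theorem lintegral_eq_lintegral_span_orthogonal (ω : UnitSphere V) {F : V → ℝ≥0∞}
    (hF : Measurable F) :
    ∫⁻ y, F y = ∫⁻ a : ℝ, ∫⁻ w : (Submodule.span ℝ {(ω : V)})ᗮ, F (a • (ω : V) + w) := by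
  set K := Submodule.span ℝ {(ω : V)}
  have hω : ‖(ω : V)‖ = 1 := norm_eq_of_mem_sphere ω
  have e1 := K.orthogonalDecomposition.symm.measurePreserving
  have e2 := WithLp.volume_preserving_toLp K Kᗮ
  have e3 := (LinearIsometryEquiv.toSpanUnitSingleton (𝕜 := ℝ) (ω : V) hω).measurePreserving
  have hG : Measurable fun p => F (K.orthogonalDecomposition.symm p) := hF.comp e1.measurable
  have hH : Measurable fun p : K × Kᗮ => F (K.orthogonalDecomposition.symm (WithLp.toLp 2 p)) :=
    hG.comp e2.measurable
  rw [← e1.lintegral_comp hF, ← e2.lintegral_comp hG, Measure.volume_eq_prod,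
    lintegral_prod _ hH.aemeasurable, ← e3.lintegral_comp hH.lintegral_prod_right']
  refine lintegral_congr fun a => lintegral_congr fun w => ?_
  simp

/-- Integration over the upper half-plane in polar coordinates. -/
theorem lintegral_halfPlane {h : ℝ × ℝ → ℝ≥0∞} (hh : Measurable h) :
    ∫⁻ a : ℝ, ∫⁻ r in Ioi (0 : ℝ), h (a, r) =
      ∫⁻ r in Ioi (0 : ℝ), ∫⁻ θ in Ioo 0 Real.pi,
        ENNReal.ofReal r * h (r * Real.cos θ, r * Real.sin θ) := by
  set S : Set (ℝ × ℝ) := univ ×ˢ Ioi (0 : ℝ) with hS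
  have hSm : MeasurableSet S := MeasurableSet.univ.prod measurableSet_Ioi
  have h1 : ∫⁻ a : ℝ, ∫⁻ r in Ioi (0 : ℝ), h (a, r) = ∫⁻ p, S.indicator h p := by
    rw [lintegral_indicator hSm, Measure.volume_eq_prod, hS, ← Measure.prod_restrict,
      Measure.restrict_univ, lintegral_prod _ hh.aemeasurable]
  have hset : MeasurableSet (Ioi (0 : ℝ) ×ˢ Ioo 0 Real.pi) :=
    measurableSet_Ioi.prod measurableSet_Ioo
  rw [h1, ← lintegral_comp_polarCoord_symm, polarCoord_target]
  have h2 : ∀ p ∈ Ioi (0 : ℝ) ×ˢ Ioo (-Real.pi) Real.pi,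
      ENNReal.ofReal p.1 • S.indicator h (polarCoord.symm p) =
        (Ioi (0 : ℝ) ×ˢ Ioo 0 Real.pi).indicator
          (fun p => ENNReal.ofReal p.1 * h (p.1 * Real.cos p.2, p.1 * Real.sin p.2)) p := by
    rintro ⟨r, θ⟩ ⟨hr, hθ⟩
    simp only [mem_Ioi, mem_Ioo] at hr hθ
    have : (r * Real.cos θ, r * Real.sin θ) ∈ S ↔ (r, θ) ∈ Ioi (0 : ℝ) ×ˢ Ioo 0 Real.pi := by
      simp only [hS, mem_prod, mem_univ, true_and, mem_Ioi, mem_Ioo, hr, hθ.2, and_true]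
      constructor
      · intro h
        by_contra hc
        have := Real.sin_nonpos_of_nonpos_of_neg_pi_le (not_lt.1 hc) hθ.1.le
        nlinarith
      · intro h
        exact mul_pos hr (Real.sin_pos_of_pos_of_lt_pi h hθ.2)
    simp only [polarCoord_symm_apply, smul_eq_mul, indicator_apply, this]
    split_ifs <;> simp
  rw [setLIntegral_congr_fun (measurableSet_Ioi.prod measurableSet_Ioo) h2,
    setLIntegral_indicator hset, inter_eq_left.2, Measure.volume_eq_prod, ← Measure.prod_restrict,
    lintegral_prod _ (by fun_prop)]
  exact prod_mono le_rfl (Ioo_subset_Ioo (by linarith [Real.pi_pos]) le_rfl)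

/-- Substitution $s=\cos\theta$, injective on $(0,\pi)$: one factor of $\sin^m\theta$ is the
Jacobian and the others give $(1-s^2)^{(m-1)/2}$. -/
theorem lintegral_cos_eq (m : ℕ) {g : ℝ → ℝ≥0∞} :
    ∫⁻ θ in Ioo 0 Real.pi, ENNReal.ofReal (Real.sin θ ^ m) * g (Real.cos θ) =
      ∫⁻ s in Ioo (-1 : ℝ) 1, ENNReal.ofReal ((1 - s ^ 2) ^ (((m : ℝ) - 1) / 2)) * g s := by
  have him : Real.cos '' Ioo 0 Real.pi = Ioo (-1 : ℝ) 1 := by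
    ext s
    constructor
    · rintro ⟨θ, hθ, rfl⟩
      have h1 := Real.strictAntiOn_cos ⟨le_rfl, Real.pi_pos.le⟩ (Ioo_subset_Icc_self hθ) hθ.1
      have h2 := Real.strictAntiOn_cos (Ioo_subset_Icc_self hθ) ⟨Real.pi_pos.le, le_rfl⟩ hθ.2
      rw [Real.cos_zero] at h1
      rw [Real.cos_pi] at h2
      exact ⟨h2, h1⟩
    · intro hs
      exact ⟨Real.arccos s, ⟨Real.arccos_pos.2 hs.2, Real.arccos_lt_pi.2 hs.1⟩,
        Real.cos_arccos hs.1.le hs.2.le⟩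
  rw [← him, lintegral_image_eq_lintegral_abs_deriv_mul measurableSet_Ioo
    (fun x _ => (Real.hasDerivAt_cos x).hasDerivWithinAt)
    (Real.injOn_cos.mono Ioo_subset_Icc_self)]
  refine setLIntegral_congr_fun measurableSet_Ioo fun θ hθ => ?_
  have hs : 0 < Real.sin θ := Real.sin_pos_of_pos_of_lt_pi hθ.1 hθ.2
  have hp : Real.sin θ ^ m = Real.sin θ * (1 - Real.cos θ ^ 2) ^ (((m : ℝ) - 1) / 2) := by
    rw [← Real.sin_sq, ← Real.rpow_natCast (Real.sin θ) 2, ← Real.rpow_mul hs.le,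
      ← Real.rpow_natCast, show (m : ℝ) = 1 + ((2 : ℕ) : ℝ) * (((m : ℝ) - 1) / 2) by
        push_cast; ring, Real.rpow_add hs, Real.rpow_one]
    congr 3
    ring
  rw [hp, ← mul_assoc, abs_neg, abs_of_pos hs, ENNReal.ofReal_mul hs.le]

/-- The integral over $V$ of a function of $|y|$ and of the angle between $y$ and $\omega$ is
computed twice: in polar coordinates of $V$, and by splitting off $\omega$, using polar coordinates
in $\omega^\perp$ and then in the half-plane of (height, radius). The radial factor is the same on
both sides and cancels. -/
theorem lintegral_inner_sphere {m : ℕ} (hm : Module.finrank ℝ V = m + 2) (ω : UnitSphere V)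
    {g : ℝ → ℝ≥0∞} (hg : Measurable g) :
    ∫⁻ y : UnitSphere V, g (inner ℝ (ω : V) (y : V)) ∂(sphereMeasure V) =
      ENNReal.ofReal (sphereArea m) * ∫⁻ s in Ioo (-1 : ℝ) 1,
        ENNReal.ofReal ((1 - s ^ 2) ^ (((m : ℝ) - 1) / 2)) * g s := by
  have : Nontrivial V := Module.nontrivial_of_finrank_pos (R := ℝ) (by omega)
  have hω : ‖(ω : V)‖ = 1 := norm_eq_of_mem_sphere ω
  set W := (Submodule.span ℝ {(ω : V)})ᗮ with hW
  have hfW : Module.finrank ℝ W = m + 1 := by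
    have : Fact (Module.finrank ℝ V = (m + 1) + 1) := ⟨hm⟩
    exact Submodule.finrank_orthogonal_span_singleton (ne_zero_of_mem_unit_sphere ω)
  have : Nontrivial W := Module.nontrivial_of_finrank_pos (R := ℝ) (by omega)
  -- Any radial cut-off would do, provided its moment $C$ is neither $0$ nor $\infty$, so that it
  -- can be cancelled.
  set φ : ℝ → ℝ≥0∞ := (Iio (1 : ℝ)).indicator 1 with hφ
  have hφm : Measurable φ := measurable_one.indicator measurableSet_Iio
  set C : ℝ≥0∞ := ∫⁻ r in Ioi (0 : ℝ), ENNReal.ofReal (r ^ (m + 1)) * φ r with hC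
  have hCeq : C = ∫⁻ r in Ioo (0 : ℝ) 1, ENNReal.ofReal (r ^ (m + 1)) := by
    have : ∀ r, ENNReal.ofReal (r ^ (m + 1)) * φ r =
        (Iio (1 : ℝ)).indicator (fun r => ENNReal.ofReal (r ^ (m + 1))) r := by
      intro r
      simp only [hφ, indicator_apply]
      split_ifs <;> simp
    simp_rw [hC, this]
    rw [setLIntegral_indicator measurableSet_Iio, inter_comm, Ioi_inter_Iio]
  have hC0 : C ≠ 0 := by
    rw [hCeq]
    refine (setLIntegral_pos_iff (by fun_prop)).2 ?_ |>.ne'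
    refine lt_of_lt_of_le (b := volume (Ioo (0 : ℝ) 1)) (by simp) (measure_mono fun r hr => ?_)
    exact ⟨by simpa using pow_pos hr.1 _, hr⟩
  have hCt : C ≠ ⊤ := by
    rw [hCeq]
    refine ne_top_of_le_ne_top (b := ∫⁻ r in Ioo (0 : ℝ) 1, 1) (by simp) ?_
    refine setLIntegral_mono measurable_const fun r hr => ?_
    exact ENNReal.ofReal_le_one.2 (pow_le_one₀ hr.1.le hr.2.le)
  set F : V → ℝ≥0∞ := fun y => φ ‖y‖ * g (inner ℝ (ω : V) y / ‖y‖) with hF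
  have hFm : Measurable F := by fun_prop
  have hL : ∫⁻ y, F y =
      C * ∫⁻ y : UnitSphere V, g (inner ℝ (ω : V) (y : V)) ∂(sphereMeasure V) := by
    rw [lintegral_eq_lintegral_sphere hFm, ← lintegral_const_mul _ (by fun_prop)]
    refine lintegral_congr fun u => ?_
    rw [hC, ← lintegral_mul_const _ (by fun_prop)]
    refine setLIntegral_congr_fun measurableSet_Ioi fun r hr => ?_
    have hr' : (0 : ℝ) < r := hr
    have hu : ‖(u : V)‖ = 1 := norm_eq_of_mem_sphere u
    simp only [hF, norm_smul, hu, inner_smul_right, Real.norm_eq_abs, abs_of_pos hr', mul_one,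
      mul_div_cancel_left₀ _ hr'.ne', hm]
    rw [mul_assoc]
    rfl
  have hR : ∫⁻ y, F y = C * (ENNReal.ofReal (sphereArea m) * ∫⁻ s in Ioo (-1 : ℝ) 1,
      ENNReal.ofReal ((1 - s ^ 2) ^ (((m : ℝ) - 1) / 2)) * g s) := by
    set h : ℝ × ℝ → ℝ≥0∞ := fun p => ENNReal.ofReal (p.2 ^ m) *
      (φ (√(p.1 ^ 2 + p.2 ^ 2)) * g (p.1 / √(p.1 ^ 2 + p.2 ^ 2))) with hh
    have hhm : Measurable h := by fun_prop
    have h1 : ∀ a : ℝ, ∫⁻ w : W, F (a • (ω : V) + w) =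
        ENNReal.ofReal (sphereArea m) * ∫⁻ r in Ioi (0 : ℝ), h (a, r) := by
      intro a
      rw [lintegral_eq_lintegral_sphere (by fun_prop), ← sphereMeasure_univ hfW, mul_comm,
        ← lintegral_const]
      refine lintegral_congr fun u => setLIntegral_congr_fun measurableSet_Ioi fun r hr => ?_
      have hu : ‖((u : W) : V)‖ = 1 := norm_eq_of_mem_sphere u
      have h3 : inner ℝ (ω : V) ((u : W) : V) = 0 :=
        Submodule.mem_orthogonal_singleton_iff_inner_right.1 u.1.2
      have h4 : ‖a • (ω : V) + ((r • (u : W) : W) : V)‖ = √(a ^ 2 + r ^ 2) := by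
        rw [eq_comm, Real.sqrt_eq_iff_eq_sq (by positivity) (norm_nonneg _), norm_add_sq_real,
          Submodule.coe_smul, norm_smul, norm_smul, inner_smul_left, inner_smul_right, h3, hω, hu]
        simp
      have h5 : inner ℝ (ω : V) (a • (ω : V) + ((r • (u : W) : W) : V)) = a := by
        rw [inner_add_right, inner_smul_right, Submodule.coe_smul, inner_smul_right, h3,
          real_inner_self_eq_norm_sq, hω]
        simp
      simp only [hF, hh, h4, h5, hfW]
      rfl
    rw [lintegral_eq_lintegral_span_orthogonal ω hFm, lintegral_congr h1,
      lintegral_const_mul _ (by fun_prop), lintegral_halfPlane hhm, mul_left_comm,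
      ← lintegral_cos_eq, hC, ← lintegral_mul_const _ (by fun_prop)]
    congr 1
    refine setLIntegral_congr_fun measurableSet_Ioi fun r hr => ?_
    have hr' : (0 : ℝ) < r := hr
    rw [← lintegral_const_mul _ (by fun_prop)]
    refine setLIntegral_congr_fun measurableSet_Ioo fun θ hθ => ?_
    have hs : 0 < Real.sin θ := Real.sin_pos_of_pos_of_lt_pi hθ.1 hθ.2
    have h6 : √((r * Real.cos θ) ^ 2 + (r * Real.sin θ) ^ 2) = r := by
      rw [show (r * Real.cos θ) ^ 2 + (r * Real.sin θ) ^ 2 = r ^ 2 by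
        linear_combination r ^ 2 * Real.sin_sq_add_cos_sq θ, Real.sqrt_sq hr'.le]
    simp only [hh, h6, mul_div_cancel_left₀ _ hr'.ne']
    rw [mul_pow, ENNReal.ofReal_mul (pow_nonneg hr'.le m), pow_succ,
      ENNReal.ofReal_mul (by positivity)]
    ring
  exact (ENNReal.mul_right_inj hC0 hCt).1 (hL.symm.trans hR)

end Spheres

/-! ### Linear isometries and unit spheres -/

section Isometry

variable {V V' : Type*} [NormedAddCommGroup V] [InnerProductSpace ℝ V] [NormedAddCommGroup V']
  [InnerProductSpace ℝ V']

/-- The map of unit spheres induced by a linear isometry. -/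
def sphereMap (L : V ≃ₗᵢ[ℝ] V') (u : UnitSphere V) : UnitSphere V' :=
  ⟨L u, by simp⟩

@[simp]
theorem coe_sphereMap (L : V ≃ₗᵢ[ℝ] V') (u : UnitSphere V) : (sphereMap L u : V') = L u := rfl

theorem continuous_sphereMap (L : V ≃ₗᵢ[ℝ] V') : Continuous (sphereMap L) :=
  (L.continuous.comp continuous_subtype_val).subtype_mk _

/-- The surface measure of a set is the dimension times the volume of the cone over it, and a linear
isometry carries cones to cones and preserves volume. -/
theorem measurePreserving_sphereMap [FiniteDimensional ℝ V] [MeasurableSpace V] [BorelSpace V]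
    [FiniteDimensional ℝ V'] [MeasurableSpace V'] [BorelSpace V'] (L : V ≃ₗᵢ[ℝ] V') :
    MeasurePreserving (sphereMap L) (sphereMeasure V) (sphereMeasure V') := by
  have hm : Measurable (sphereMap L) := (continuous_sphereMap L).measurable
  refine ⟨hm, Measure.ext fun s hs => ?_⟩
  rw [Measure.map_apply hm hs, sphereMeasure, sphereMeasure, Measure.toSphere_apply' _ (hm hs),
    Measure.toSphere_apply' _ hs, L.toLinearEquiv.finrank_eq]
  congr 1
  rw [← L.measurePreserving.measure_preimage_emb L.toHomeomorph.measurableEmbedding]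
  congr 1
  ext v
  simp only [mem_preimage, Set.mem_smul, mem_image]
  constructor
  · rintro ⟨r, hr, _, ⟨u, hu, rfl⟩, rfl⟩
    exact ⟨r, hr, _, ⟨_, hu, rfl⟩, by simp⟩
  · rintro ⟨r, hr, _, ⟨u, hu, rfl⟩, h⟩
    refine ⟨r, hr, _, ⟨sphereMap L.symm u, ?_, rfl⟩, ?_⟩
    · have : sphereMap L (sphereMap L.symm u) = u := Subtype.ext (by simp)
      rwa [this]
    · rw [coe_sphereMap, ← map_smul, h, L.symm_apply_apply]

end Isometry

/-! ### Averages over orbits -/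

/-- A right-invariant probability measure on a group that acts transitively induces the normalized
invariant measure on the orbit. -/
theorem lintegral_orbit {G X : Type*} [Group G] [MeasurableSpace G] [MeasurableMul G]
    [MeasurableSpace X] (ν : Measure G) [IsProbabilityMeasure ν] [ν.IsMulRightInvariant]
    (σ : Measure X) [IsFiniteMeasure σ] {a : G → X → X} (ha : Measurable (Function.uncurry a))
    (hmul : ∀ g h x, a (g * h) x = a g (a h x)) (hinv : ∀ g, MeasurePreserving (a g) σ σ)
    {x₀ : X} (htr : ∀ x, ∃ g, a g x₀ = x) {F : X → ℝ≥0∞} (hF : Measurable F) :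
    ∫⁻ x, F x ∂σ = (∫⁻ g, F (a g x₀) ∂ν) * σ univ := by
  have h1 : ∀ x, ∫⁻ g, F (a g x) ∂ν = ∫⁻ g, F (a g x₀) ∂ν := by
    intro x
    -- Writing $x=h x_0$ turns the $g$-average at $x$ into a right translate of the average at
    -- $x_0$.
    obtain ⟨h, rfl⟩ := htr x
    simp_rw [← hmul]
    exact lintegral_mul_right_eq_self (fun g => F (a g x₀)) h
  calc ∫⁻ x, F x ∂σ = ∫⁻ g, ∫⁻ x, F (a g x) ∂σ ∂ν := by
        simp_rw [fun g => (hinv g).lintegral_comp hF]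
        simp
    _ = ∫⁻ x, ∫⁻ g, F (a g x) ∂ν ∂σ := lintegral_lintegral_swap (hF.comp ha).aemeasurable
    _ = _ := by simp_rw [h1]; rw [lintegral_const]

/-- A compact group is unimodular: a right translate of the Haar probability measure is again a Haar
probability measure, hence equal to it. -/
theorem isMulRightInvariant_of_isHaarMeasure {G : Type*} [Group G] [TopologicalSpace G]
    [IsTopologicalGroup G] [CompactSpace G] [MeasurableSpace G] [BorelSpace G] (ν : Measure G)
    [IsProbabilityMeasure ν] [ν.IsHaarMeasure] [SecondCountableTopology G] :
    ν.IsMulRightInvariant := by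
  refine ⟨fun g => ?_⟩
  have : IsProbabilityMeasure (ν.map (· * g)) :=
    Measure.isProbabilityMeasure_map (measurable_mul_const g).aemeasurable
  exact Measure.isHaarMeasure_eq_of_isProbabilityMeasure _ _

/-! ### Rotations of the sphere -/

section Rotations

variable {n : ℕ}

theorem SO.toLinearEquiv_mul (A B : SO n) (x : Euc n) :
    (A * B).toLinearEquiv x = A.toLinearEquiv (B.toLinearEquiv x) := by
  change Matrix.toEuclideanLin (A.1 * B.1) _ =
    Matrix.toEuclideanLin A.1 (Matrix.toEuclideanLin B.1 _)
  simp [Matrix.toLpLin_apply, Matrix.mulVec_mulVec]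

theorem SO.norm_toLinearEquiv (A : SO n) (x : Euc n) : ‖A.toLinearEquiv x‖ = ‖x‖ := by
  rw [← sq_eq_sq₀ (norm_nonneg _) (norm_nonneg _), ← real_inner_self_eq_norm_sq,
    ← real_inner_self_eq_norm_sq]
  change inner ℝ (Matrix.toEuclideanLin A.1 x) (Matrix.toEuclideanLin A.1 x) = _
  rw [EuclideanSpace.inner_eq_star_dotProduct, EuclideanSpace.inner_eq_star_dotProduct]
  simp only [star_trivial, Matrix.toLpLin_apply]
  rw [Matrix.dotProduct_mulVec, ← Matrix.mulVec_transpose, Matrix.mulVec_mulVec,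
    (SO.mem_iff.1 A.2).1, Matrix.one_mulVec]

/-- A rotation as a linear isometry. -/
def SO.iso (A : SO n) : Euc n ≃ₗᵢ[ℝ] Euc n := ⟨A.toLinearEquiv, A.norm_toLinearEquiv⟩

/-- The action of the rotations on the unit sphere. -/
def rot (A : SO n) : UnitSphere (Euc n) → UnitSphere (Euc n) := sphereMap A.iso

theorem coe_rot (A : SO n) (x : UnitSphere (Euc n)) : (rot A x : Euc n) = A.toLinearEquiv x := rfl

theorem rot_mul (A B : SO n) (x : UnitSphere (Euc n)) : rot (A * B) x = rot A (rot B x) :=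
  Subtype.ext (SO.toLinearEquiv_mul A B x)

theorem continuous_rot : Continuous fun p : SO n × UnitSphere (Euc n) => rot p.1 p.2 := by
  refine Continuous.subtype_mk ?_ _
  change Continuous fun p : SO n × UnitSphere (Euc n) =>
    Matrix.toEuclideanLin p.1.1 (p.2 : Euc n)
  simp only [Matrix.toLpLin_apply]
  exact (PiLp.continuous_toLp 2 _).comp
    ((continuous_subtype_val.comp continuous_fst).matrix_mulVec
      ((PiLp.continuous_ofLp 2 _).comp (continuous_subtype_val.comp continuous_snd)))

theorem map_orthogonal_span (A : SO n) (x : UnitSphere (Euc n)) :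
    (Submodule.span ℝ {(x : Euc n)})ᗮ.map (A.toLinearEquiv : Euc n →ₗ[ℝ] Euc n) =
      (Submodule.span ℝ {(rot A x : Euc n)})ᗮ := by
  have h := Submodule.map_orthogonal_equiv (Submodule.span ℝ {(x : Euc n)}) A.iso
  rw [Submodule.map_span, image_singleton] at h
  exact h

/-- The restriction of a rotation to the orthogonal complement of a unit vector. -/
def perpIso (A : SO n) {x y : UnitSphere (Euc n)} (h : rot A x = y) :
    (Submodule.span ℝ {(x : Euc n)})ᗮ ≃ₗᵢ[ℝ] (Submodule.span ℝ {(y : Euc n)})ᗮ :=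
  ⟨A.toLinearEquiv.ofSubmodules _ _ (h ▸ map_orthogonal_span A x), fun v =>
    A.norm_toLinearEquiv v⟩

theorem coe_perpIso (A : SO n) {x y : UnitSphere (Euc n)} (h : rot A x = y)
    (v : (Submodule.span ℝ {(x : Euc n)})ᗮ) : (perpIso A h v : Euc n) = A.toLinearEquiv v := rfl

theorem rot_sliceMap (A : SO n) {x y : UnitSphere (Euc n)} (h : rot A x = y) (t : ℝ)
    (u : UnitSphere (Submodule.span ℝ {(x : Euc n)})ᗮ) :
    rot A (sliceMap x t u) = sliceMap y t (sphereMap (perpIso A h) u) := by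
  have h' : A.toLinearEquiv x = (y : Euc n) := by rw [← h]; rfl
  refine Subtype.ext ?_
  rw [coe_rot]
  unfold sliceMap
  split_ifs
  · simp [h', coe_perpIso]
  · exact h'

/-- A unit vector of a subspace as a point of the unit sphere of the whole space. -/
def perpPoint {W : Submodule ℝ (Euc n)} (u : UnitSphere W) : UnitSphere (Euc n) :=
  ⟨((u : W) : Euc n), mem_sphere_zero_iff_norm.2 (norm_eq_of_mem_sphere u)⟩

theorem continuous_perpPoint {W : Submodule ℝ (Euc n)} : Continuous (perpPoint (W := W)) :=
  (continuous_subtype_val.comp continuous_subtype_val).subtype_mk _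

theorem coe_sliceMap (x : UnitSphere (Euc n)) {t : ℝ} (ht : t ^ 2 ≤ 1)
    (u : UnitSphere (Submodule.span ℝ {(x : Euc n)})ᗮ) : (sliceMap x t u : Euc n) =
      t • (x : Euc n) + √(1 - t ^ 2) • ((u : (Submodule.span ℝ {(x : Euc n)})ᗮ) : Euc n) := by
  unfold sliceMap
  rw [dif_pos ht]

theorem measurable_sliceMap (x : UnitSphere (Euc n)) :
    Measurable fun p : ℝ × UnitSphere (Submodule.span ℝ {(x : Euc n)})ᗮ => sliceMap x p.1 p.2 := by
  rw [← (MeasurableEmbedding.subtype_coe isClosed_sphere.measurableSet).measurable_comp_iff]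
  have h : Measurable fun p : ℝ × UnitSphere (Submodule.span ℝ {(x : Euc n)})ᗮ =>
      if p.1 ^ 2 ≤ 1 then p.1 • (x : Euc n) +
        √(1 - p.1 ^ 2) • ((p.2 : (Submodule.span ℝ {(x : Euc n)})ᗮ) : Euc n) else x := by
    refine Measurable.ite (measurableSet_le (by fun_prop) measurable_const) ?_ measurable_const
    fun_prop
  convert! h using 1
  ext1 p
  unfold sliceMap
  simp only [Function.comp]
  split_ifs <;> rfl

theorem inner_sliceMap (x : UnitSphere (Euc n)) {t : ℝ} (ht : t ^ 2 ≤ 1)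
    (u : UnitSphere (Submodule.span ℝ {(x : Euc n)})ᗮ) :
    inner ℝ (x : Euc n) (sliceMap x t u : Euc n) = t := by
  have h3 : inner ℝ (x : Euc n) ((u : (Submodule.span ℝ {(x : Euc n)})ᗮ) : Euc n) = 0 :=
    Submodule.mem_orthogonal_singleton_iff_inner_right.1 u.1.2
  rw [coe_sliceMap x ht, inner_add_right, inner_smul_right, inner_smul_right, h3,
    real_inner_self_eq_norm_sq, norm_eq_of_mem_sphere x]
  simp

theorem neg_sliceMap (x : UnitSphere (Euc n)) {t : ℝ} (ht : t ^ 2 ≤ 1)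
    (u : UnitSphere (Submodule.span ℝ {(x : Euc n)})ᗮ) :
    -sliceMap x t u = sliceMap x (-t) (-u) := by
  refine Subtype.ext ?_
  have h1 := coe_sliceMap x ht u
  have h2 := coe_sliceMap x (t := -t) (by simpa using ht) (-u)
  rw [h2]
  change -(sliceMap x t u : Euc n) = _
  rw [h1]
  change _ = _ + _ • -((u : (Submodule.span ℝ {(x : Euc n)})ᗮ) : Euc n)
  simp
  abel

theorem dist_sliceMap_sq (x : UnitSphere (Euc n)) {t : ℝ} (ht : t ^ 2 ≤ 1)
    (u : UnitSphere (Submodule.span ℝ {(x : Euc n)})ᗮ) :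
    dist (sliceMap x t u) x ^ 2 = 2 - 2 * t := by
  rw [Subtype.dist_eq, dist_eq_norm, norm_sub_sq_real, real_inner_comm, inner_sliceMap x ht,
    norm_eq_of_mem_sphere x, norm_eq_of_mem_sphere (sliceMap x t u)]
  ring

/-! ### Topology and Haar measures of $SO(n)$ and $K$, and transitivity of $K$ on the equator. -/

instance instSecondCountableSO : SecondCountableTopology (SO n) :=
  have : SecondCountableTopology (Matrix (Fin n) (Fin n) ℝ) :=
    inferInstanceAs (SecondCountableTopology (Fin n → Fin n → ℝ))
  TopologicalSpace.Subtype.secondCountableTopology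
    (Matrix.specialOrthogonalGroup (Fin n) ℝ : Set (Matrix (Fin n) (Fin n) ℝ))

instance [Fact (3 ≤ n)] : SecondCountableTopology (stabK n) :=
  TopologicalSpace.Subtype.secondCountableTopology (stabK n : Set (SO n))

instance instMeasurableSpaceSO : MeasurableSpace (SO n) := borel _

instance instBorelSpaceSO : BorelSpace (SO n) := ⟨rfl⟩

/-- Needed to descend measurability along the surjection $A\mapsto Ae_n$ from $SO(n)$ onto the
sphere. -/
instance instPolishSpaceSO : PolishSpace (SO n) := by
  have : T3Space (SO n) := inferInstance
  have : TopologicalSpace.MetrizableSpace (SO n) :=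
    TopologicalSpace.metrizableSpace_of_t3_secondCountable _
  let := TopologicalSpace.metrizableSpaceMetric (SO n)
  infer_instance

/-- The normalized Haar measure of `SO(n)`. -/
def haarSO (n : ℕ) : Measure (SO n) := Measure.haarMeasure ⊤

instance : IsProbabilityMeasure (haarSO n) :=
  ⟨Measure.haarMeasure_self (K₀ := (⊤ : TopologicalSpace.PositiveCompacts (SO n)))⟩

instance : (haarSO n).IsHaarMeasure := by unfold haarSO; infer_instance

instance : (haarSO n).IsMulRightInvariant := isMulRightInvariant_of_isHaarMeasure _

variable [hn : Fact (3 ≤ n)]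

instance : IsProbabilityMeasure (haarK n) :=
  ⟨Measure.haarMeasure_self (K₀ := (⊤ : TopologicalSpace.PositiveCompacts (stabK n)))⟩

instance : (haarK n).IsHaarMeasure := by unfold haarK; infer_instance

instance : (haarK n).IsMulRightInvariant := isMulRightInvariant_of_isHaarMeasure _

theorem finrank_orthogonal_span (x : UnitSphere (Euc n)) :
    Module.finrank ℝ (Submodule.span ℝ {(x : Euc n)})ᗮ = (n - 2) + 1 := by
  have h3 := hn.out
  have : Fact (Module.finrank ℝ (Euc n) = ((n - 2) + 1) + 1) := ⟨by simp; omega⟩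
  exact Submodule.finrank_orthogonal_span_singleton (ne_zero_of_mem_unit_sphere x)

theorem sphereMeasure_orthogonal_univ (x : UnitSphere (Euc n)) :
    sphereMeasure (Submodule.span ℝ {(x : Euc n)})ᗮ univ =
      ENNReal.ofReal (sphereArea (n - 2)) :=
  sphereMeasure_univ (finrank_orthogonal_span x)

theorem rot_stabK (ρ : stabK n) : rot (ρ : SO n) (eLast n) = eLast n := Subtype.ext ρ.2

/-- The action of the stabilizer of `e_n` on the unit sphere of `e_n^⊥`. -/
def perpRot (ρ : stabK n) : UnitSphere (Submodule.span ℝ {(eLast n : Euc n)})ᗮ →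
    UnitSphere (Submodule.span ℝ {(eLast n : Euc n)})ᗮ :=
  sphereMap (perpIso (ρ : SO n) (rot_stabK ρ))

theorem continuous_perpRot : Continuous (Function.uncurry (perpRot (n := n))) := by
  have h1 : Continuous fun p : stabK n × UnitSphere (Submodule.span ℝ {(eLast n : Euc n)})ᗮ =>
      (p.1 : SO n) := by fun_prop
  have h2 : Continuous fun p : stabK n × UnitSphere (Submodule.span ℝ {(eLast n : Euc n)})ᗮ =>
      perpPoint p.2 := continuous_perpPoint.comp continuous_snd
  have h : Continuous fun p : stabK n × UnitSphere (Submodule.span ℝ {(eLast n : Euc n)})ᗮ =>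
      rot (p.1 : SO n) (perpPoint p.2) :=
    Continuous.comp (g := fun p : SO n × UnitSphere (Euc n) => rot p.1 p.2)
      (f := fun p : stabK n × UnitSphere (Submodule.span ℝ {(eLast n : Euc n)})ᗮ =>
        ((p.1 : SO n), perpPoint p.2)) continuous_rot (Continuous.prodMk h1 h2)
  have h4 := continuous_subtype_val.comp h
  exact Continuous.subtype_mk (Continuous.subtype_mk h4 _) _

/-- Complete $u$ and $e_n$ to an orthonormal basis and use it as columns. The sign of the
determinant is repaired in the second column, which is neither the one holding $u$ nor the one
holding $e_n$ because $n\ge 3$. -/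
theorem exists_stabK_apply (u : UnitSphere (Submodule.span ℝ {(eLast n : Euc n)})ᗮ) :
    ∃ ρ : stabK n, (ρ : SO n).toLinearEquiv
      (EuclideanSpace.single ⟨0, by have := hn.out; omega⟩ 1) =
        ((u : (Submodule.span ℝ {(eLast n : Euc n)})ᗮ) : Euc n) := by
  have h3 := hn.out
  set i₀ : Fin n := ⟨0, by omega⟩ with hi₀
  set k : Fin n := ⟨1, by omega⟩ with hk
  have h0l : i₀ ≠ lastIdx n := by simp [lastIdx, hi₀]; omega
  have hkl : lastIdx n ≠ k := by simp [lastIdx, hk]; omega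
  have h0k : i₀ ≠ k := by simp [hi₀, hk]
  set w : Euc n := ((u : (Submodule.span ℝ {(eLast n : Euc n)})ᗮ) : Euc n) with hw
  have hwn : ‖w‖ = 1 := norm_eq_of_mem_sphere u
  have hwo : inner ℝ (eLast n : Euc n) w = 0 :=
    Submodule.mem_orthogonal_singleton_iff_inner_right.1 u.1.2
  obtain ⟨b, hb⟩ := Orthonormal.exists_orthonormalBasis_extension_of_card_eq (𝕜 := ℝ)
    (E := Euc n) (ι := Fin n) (v := fun i => if i = i₀ then w else (eLast n : Euc n))
    (s := {i₀, lastIdx n}) (by simp) (by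
      constructor
      · rintro ⟨i, hi⟩
        by_cases h : i = i₀
        · simpa [h] using hwn
        · simp [h]
      · rintro ⟨i, hi⟩ ⟨j, hj⟩ hij
        have hij' : i ≠ j := fun h => hij (Subtype.ext h)
        rcases hi with rfl | hi <;> rcases hj with rfl | hj
        · exact absurd rfl hij'
        · have : j ≠ i₀ := hij'.symm
          simpa [this, real_inner_comm] using hwo
        · simpa [hij', real_inner_comm] using hwo
        · exact absurd (hi.trans hj.symm) hij')
  have hb0 : b i₀ = w := by simpa using hb i₀ (by simp)
  have hbl : b (lastIdx n) = eLast n := by simpa [h0l.symm] using hb (lastIdx n) (by simp)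
  set B : Matrix (Fin n) (Fin n) ℝ := Matrix.of fun i j => b j i with hB
  have hBB : Bᵀ * B = 1 := by
    ext i j
    have h := orthonormal_iff_ite.1 b.orthonormal j i
    rw [PiLp.inner_apply] at h
    simpa [Matrix.mul_apply, hB, Matrix.one_apply, eq_comm] using h
  have hdet : B.det * B.det = 1 := by
    have hd := congrArg Matrix.det hBB
    rwa [Matrix.det_mul, Matrix.det_transpose, Matrix.det_one] at hd
  set D : Matrix (Fin n) (Fin n) ℝ := Matrix.diagonal (Function.update 1 k B.det) with hD
  have hDdet : D.det = B.det := by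
    rw [hD, Matrix.det_diagonal, Finset.prod_update_of_mem (Finset.mem_univ k)]
    simp
  have hmem : B * D ∈ Matrix.specialOrthogonalGroup (Fin n) ℝ := by
    refine SO.mem_iff.2 ⟨?_, ?_⟩
    · rw [Matrix.transpose_mul, Matrix.mul_assoc, ← Matrix.mul_assoc Bᵀ, hBB, Matrix.one_mul, hD,
        Matrix.diagonal_transpose, Matrix.diagonal_mul_diagonal, ← Matrix.diagonal_one]
      congr 1
      ext i
      by_cases hi : i = k
      · subst hi
        simpa using hdet
      · simp [hi]
    · rw [Matrix.det_mul, hDdet, hdet]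
  have happ : ∀ i, i ≠ k → SO.toLinearEquiv ⟨B * D, hmem⟩ (EuclideanSpace.single i 1) =
      b i := by
    intro i hi
    change Matrix.toEuclideanLin (B * D) (EuclideanSpace.single i 1) = b i
    ext j
    simp [Matrix.toLpLin_apply, hB, hD, Function.update_of_ne hi]
  exact ⟨⟨⟨B * D, hmem⟩, (happ _ hkl).trans hbl⟩, (happ _ h0k).trans hb0⟩

theorem perpRot_transitive (u₀ u : UnitSphere (Submodule.span ℝ {(eLast n : Euc n)})ᗮ) :
    ∃ ρ : stabK n, perpRot ρ u₀ = u := by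
  obtain ⟨ρ, hρ⟩ := exists_stabK_apply u
  obtain ⟨ρ₀, hρ₀⟩ := exists_stabK_apply u₀
  refine ⟨ρ * ρ₀⁻¹, Subtype.ext (Subtype.ext ?_)⟩
  change ((ρ : SO n) * (ρ₀ : SO n)⁻¹).toLinearEquiv
    ((u₀ : (Submodule.span ℝ {(eLast n : Euc n)})ᗮ) : Euc n) = _
  rw [← hρ, ← hρ₀, ← SO.toLinearEquiv_mul, inv_mul_cancel_right]

end Rotations

/-! ### Integration over spheres by slices -/

section Zonal

variable {V : Type*} [NormedAddCommGroup V] [InnerProductSpace ℝ V] [FiniteDimensional ℝ V]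
  [MeasurableSpace V] [BorelSpace V]

/-- Stating the zonal formula as an equality of measures makes it available for vector-valued
integrals. -/
theorem map_inner_sphereMeasure {m : ℕ} (hm : Module.finrank ℝ V = m + 2) (ω : UnitSphere V) :
    (sphereMeasure V).map (fun y : UnitSphere V => inner ℝ (ω : V) (y : V)) =
      (volume.restrict (Ioo (-1 : ℝ) 1)).withDensity fun s =>
        ENNReal.ofReal (sphereArea m * (1 - s ^ 2) ^ (((m : ℝ) - 1) / 2)) := by
  refine Measure.ext_of_lintegral _ fun g hg => ?_
  rw [lintegral_map hg (by fun_prop), lintegral_inner_sphere hm ω hg,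
    lintegral_withDensity_eq_lintegral_mul _ (by fun_prop) hg,
    ← lintegral_const_mul _ (by fun_prop)]
  refine lintegral_congr fun s => ?_
  rw [Pi.mul_apply, ENNReal.ofReal_mul (sphereArea_pos m).le, mul_assoc]

theorem integral_inner_sphere {m : ℕ} (hm : Module.finrank ℝ V = m + 2) (ω : UnitSphere V)
    {E : Type*} [NormedAddCommGroup E] [NormedSpace ℝ E] {h : ℝ → E} (hh : StronglyMeasurable h) :
    ∫ y : UnitSphere V, h (inner ℝ (ω : V) (y : V)) ∂(sphereMeasure V) =
      sphereArea m • ∫ s in Ioo (-1 : ℝ) 1, (1 - s ^ 2) ^ (((m : ℝ) - 1) / 2) • h s := by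
  have hφ : AEMeasurable (fun y : UnitSphere V => inner ℝ (ω : V) (y : V)) (sphereMeasure V) := by
    fun_prop
  rw [← integral_map hφ hh.aestronglyMeasurable, map_inner_sphereMeasure hm,
    integral_withDensity_eq_integral_toReal_smul (by fun_prop) (by simp), ← integral_smul]
  refine setIntegral_congr_fun measurableSet_Ioo fun s hs => ?_
  have h1 : 0 ≤ 1 - s ^ 2 := by nlinarith [hs.1, hs.2]
  rw [ENNReal.toReal_ofReal (mul_nonneg (sphereArea_pos m).le (Real.rpow_nonneg h1 _)), mul_smul]

end Zonal

/-! ### Normalized slice measures as images of the Haar measure of $K$. -/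

section Slices

variable {n : ℕ}

/-- The normalized Lebesgue measure on a slice. -/
def sliceProb (x : UnitSphere (Euc n)) (t : ℝ) : Measure (UnitSphere (Euc n)) :=
  (ENNReal.ofReal (sphereArea (n - 2)))⁻¹ •
    (sphereMeasure (Submodule.span ℝ {(x : Euc n)})ᗮ).map (sliceMap x t)

theorem measurable_sliceMap_right (x : UnitSphere (Euc n)) (t : ℝ) : Measurable (sliceMap x t) :=
  (measurable_sliceMap x).comp measurable_prodMk_left

theorem measurable_rot (A : SO n) : Measurable (rot A) := (continuous_sphereMap _).measurable

theorem measurePreserving_rot (A : SO n) :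
    MeasurePreserving (rot A) (sphereMeasure (Euc n)) (sphereMeasure (Euc n)) :=
  measurePreserving_sphereMap _

/-- The powers $(1-t^2)^{\pm(n-2)/2}$ cancel, which requires $|t|<1$. -/
theorem sliceMean_eq_integral {𝕜 : Type*} [RCLike 𝕜] (f : UnitSphere (Euc n) → 𝕜)
    (x : UnitSphere (Euc n)) {t : ℝ} (ht : t ∈ Ioo (-1 : ℝ) 1) :
    sliceMean t f x = ∫ y, f y ∂(sliceProb x t) := by
  have h1 : 0 < 1 - t ^ 2 := by nlinarith [ht.1, ht.2]
  rw [sliceMean, sliceMeasure, sliceProb, integral_smul_measure, integral_smul_measure, smul_smul,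
    ENNReal.toReal_inv, ENNReal.toReal_ofReal (sphereArea_pos _).le,
    ENNReal.toReal_ofReal (by positivity)]
  congr 1
  rw [div_mul_eq_mul_div, ← Real.rpow_add h1]
  ring_nf
  simp

theorem lintegral_sliceProb (x : UnitSphere (Euc n)) (t : ℝ) {F : UnitSphere (Euc n) → ℝ≥0∞}
    (hF : Measurable F) : ∫⁻ y, F y ∂(sliceProb x t) = (ENNReal.ofReal (sphereArea (n - 2)))⁻¹ *
      ∫⁻ u, F (sliceMap x t u) ∂(sphereMeasure (Submodule.span ℝ {(x : Euc n)})ᗮ) := by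
  rw [sliceProb, lintegral_smul_measure, lintegral_map hF (measurable_sliceMap_right x t),
    smul_eq_mul]

theorem integral_sliceProb {E : Type*} [NormedAddCommGroup E] [NormedSpace ℝ E]
    (x : UnitSphere (Euc n)) (t : ℝ) {F : UnitSphere (Euc n) → E}
    (hF : StronglyMeasurable F) : ∫ y, F y ∂(sliceProb x t) = (sphereArea (n - 2))⁻¹ •
      ∫ u, F (sliceMap x t u) ∂(sphereMeasure (Submodule.span ℝ {(x : Euc n)})ᗮ) := by
  rw [sliceProb, integral_smul_measure, integral_map
    (measurable_sliceMap_right x t).aemeasurable hF.aestronglyMeasurable,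
    ENNReal.toReal_inv, ENNReal.toReal_ofReal (sphereArea_pos _).le]

theorem measurable_lintegral_sliceProb (x : UnitSphere (Euc n)) {F : UnitSphere (Euc n) → ℝ≥0∞}
    (hF : Measurable F) : Measurable fun t => ∫⁻ y, F y ∂(sliceProb x t) := by
  simp_rw [lintegral_sliceProb x _ hF]
  exact ((hF.comp (measurable_sliceMap x)).lintegral_prod_right').const_mul _

theorem stronglyMeasurable_integral_sliceProb {E : Type*} [NormedAddCommGroup E] [NormedSpace ℝ E]
    (x : UnitSphere (Euc n)) {F : UnitSphere (Euc n) → E}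
    (hF : StronglyMeasurable F) : StronglyMeasurable fun t => ∫ y, F y ∂(sliceProb x t) := by
  simp_rw [integral_sliceProb x _ hF]
  exact ((hF.comp_measurable (measurable_sliceMap x)).integral_prod_right').const_smul _

theorem map_rot_sliceProb (A : SO n) {x y : UnitSphere (Euc n)} (h : rot A x = y) (t : ℝ) :
    (sliceProb x t).map (rot A) = sliceProb y t := by
  rw [sliceProb, sliceProb, Measure.map_smul,
    Measure.map_map (measurable_rot A) (measurable_sliceMap_right x t),
    ← (measurePreserving_sphereMap (perpIso A h)).map_eq,
    Measure.map_map (measurable_sliceMap_right y t) (continuous_sphereMap _).measurable]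
  congr 2
  ext1 u
  exact rot_sliceMap A h t u

theorem continuous_rot_apply (y : UnitSphere (Euc n)) : Continuous fun A : SO n => rot A y :=
  Continuous.comp (g := fun p : SO n × UnitSphere (Euc n) => rot p.1 p.2)
    (f := fun A : SO n => (A, y)) continuous_rot (continuous_id.prodMk continuous_const)

variable [hn : Fact (3 ≤ n)]

/-- True for all real $t$: for $t^2>1$ the default value of `sliceMap` makes this the point mass at
$x$. -/
instance (x : UnitSphere (Euc n)) (t : ℝ) : IsProbabilityMeasure (sliceProb x t) := by
  refine ⟨?_⟩
  rw [sliceProb, Measure.smul_apply, Measure.map_apply (measurable_sliceMap_right x t) .univ,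
    preimage_univ, sphereMeasure_orthogonal_univ, smul_eq_mul]
  exact ENNReal.inv_mul_cancel (by simpa using sphereArea_pos (n - 2)) ENNReal.ofReal_ne_top

/-- The direction is the normalized component of $y$ orthogonal to $x$. When $y=\pm x$ that
component vanishes and any direction serves. -/
theorem exists_sliceMap_eq (x y : UnitSphere (Euc n)) :
    ∃ u, sliceMap x (inner ℝ (x : Euc n) (y : Euc n)) u = y := by
  set t := inner ℝ (x : Euc n) (y : Euc n) with ht
  have hx : ‖(x : Euc n)‖ = 1 := norm_eq_of_mem_sphere x
  have hy : ‖(y : Euc n)‖ = 1 := norm_eq_of_mem_sphere y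
  have ht1 : t ^ 2 ≤ 1 := by
    have := abs_real_inner_le_norm (x : Euc n) (y : Euc n)
    rw [hx, hy, mul_one] at this
    exact (sq_le_one_iff_abs_le_one _).2 this
  have hs : ‖(y : Euc n) - t • (x : Euc n)‖ ^ 2 = 1 - t ^ 2 := by
    rw [norm_sub_sq_real, norm_smul, inner_smul_right, real_inner_comm, ← ht, hx, hy,
      Real.norm_eq_abs, mul_one, sq_abs]
    ring
  have hmem : (y : Euc n) - t • (x : Euc n) ∈ (Submodule.span ℝ {(x : Euc n)})ᗮ := by
    rw [Submodule.mem_orthogonal_singleton_iff_inner_right, inner_sub_right, inner_smul_right,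
      real_inner_self_eq_norm_sq, hx, ← ht]
    ring
  have hsq : ‖(y : Euc n) - t • (x : Euc n)‖ = √(1 - t ^ 2) := by
    rw [← hs, Real.sqrt_sq (norm_nonneg _)]
  by_cases h0 : √(1 - t ^ 2) = 0
  · have : Nontrivial (Submodule.span ℝ {(x : Euc n)})ᗮ :=
      Module.nontrivial_of_finrank_pos (R := ℝ) (by rw [finrank_orthogonal_span]; omega)
    obtain ⟨u, hu⟩ := (NormedSpace.sphere_nonempty (E := (Submodule.span ℝ {(x : Euc n)})ᗮ)
      (x := 0) (r := 1)).2 zero_le_one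
    refine ⟨⟨u, hu⟩, Subtype.ext ?_⟩
    rw [coe_sliceMap x ht1, h0, zero_smul, add_zero]
    rw [h0, norm_eq_zero, sub_eq_zero] at hsq
    exact hsq.symm
  · refine ⟨⟨(√(1 - t ^ 2))⁻¹ • ⟨_, hmem⟩, ?_⟩, Subtype.ext ?_⟩
    · rw [mem_sphere_zero_iff_norm, norm_smul, Submodule.coe_norm, hsq, norm_inv,
        Real.norm_of_nonneg (Real.sqrt_nonneg _), inv_mul_cancel₀ h0]
    · rw [coe_sliceMap x ht1]
      simp only [Submodule.coe_smul, smul_smul, mul_inv_cancel₀ h0, one_smul]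
      abel

theorem continuous_rot_left (A : SO n) (y : UnitSphere (Euc n)) :
    Continuous fun ρ : stabK n => rot (A * (ρ : SO n)) y :=
  Continuous.comp (g := fun p : SO n × UnitSphere (Euc n) => rot p.1 p.2)
    (f := fun ρ : stabK n => (A * (ρ : SO n), y)) continuous_rot
    ((continuous_const.mul continuous_subtype_val).prodMk continuous_const)

theorem lintegral_perpRot {F : UnitSphere (Submodule.span ℝ {(eLast n : Euc n)})ᗮ → ℝ≥0∞}
    (hF : Measurable F) (u₀ : UnitSphere (Submodule.span ℝ {(eLast n : Euc n)})ᗮ) :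
    ∫⁻ ρ, F (perpRot ρ u₀) ∂(haarK n) = (ENNReal.ofReal (sphereArea (n - 2)))⁻¹ *
      ∫⁻ u, F u ∂(sphereMeasure (Submodule.span ℝ {(eLast n : Euc n)})ᗮ) := by
  rw [lintegral_orbit (haarK n) _ continuous_perpRot.measurable
    (fun g h x => Subtype.ext (Subtype.ext (SO.toLinearEquiv_mul _ _ _)))
    (fun g => measurePreserving_sphereMap _) (perpRot_transitive u₀) hF,
    sphereMeasure_orthogonal_univ, mul_comm, mul_assoc, ENNReal.mul_inv_cancel, mul_one]
  · simpa using sphereArea_pos (n - 2)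
  · exact ENNReal.ofReal_ne_top

/-- The image of the Haar measure of the stabilizer on an orbit is a normalized slice measure. -/
theorem map_haarK (A : SO n) (y : UnitSphere (Euc n)) :
    (haarK n).map (fun ρ : stabK n => rot (A * (ρ : SO n)) y) =
      sliceProb (rot A (eLast n)) (inner ℝ (eLast n : Euc n) (y : Euc n)) := by
  rw [← map_rot_sliceProb A rfl]
  refine Measure.ext_of_lintegral _ fun F hF => ?_
  -- Elements of $K$ fix the height of $y$ and move only its equatorial direction $u_0$, so the
  -- orbit average on the sphere of $e_n^\perp$ applies.
  obtain ⟨u₀, hu₀⟩ := exists_sliceMap_eq (eLast n) y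
  set t := inner ℝ (eLast n : Euc n) (y : Euc n)
  have hFA : Measurable fun z => F (rot A z) := hF.comp (measurable_rot A)
  rw [lintegral_map hF (continuous_rot_left A y).measurable, lintegral_map hF (measurable_rot A),
    lintegral_sliceProb _ _ hFA, ← lintegral_perpRot (F := fun u => F (rot A (sliceMap _ t u)))
      (hFA.comp (measurable_sliceMap_right _ _)) u₀]
  refine lintegral_congr fun ρ => ?_
  rw [rot_mul, ← hu₀, rot_sliceMap _ (rot_stabK ρ)]
  rfl

theorem continuous_rot_rot (A : SO n) : Continuous fun p : stabK n × UnitSphere (Euc n) =>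
    rot (A * (p.1 : SO n)) p.2 :=
  Continuous.comp (g := fun p : SO n × UnitSphere (Euc n) => rot p.1 p.2)
    (f := fun p : stabK n × UnitSphere (Euc n) => (A * (p.1 : SO n), p.2)) continuous_rot
    ((continuous_const.mul (continuous_subtype_val.comp continuous_fst)).prodMk continuous_snd)

theorem exists_rot_eq (x : UnitSphere (Euc n)) : ∃ A : SO n, rot A (eLast n) = x := by
  obtain ⟨A, hA⟩ := exists_rotation x
  exact ⟨A, Subtype.ext hA⟩

theorem rot_rotationTo (x : UnitSphere (Euc n)) : rot (rotationTo x) (eLast n) = x :=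
  Subtype.ext (rotationTo_spec x)

theorem lintegral_rot_haarK (A : SO n) (y : UnitSphere (Euc n)) {F : UnitSphere (Euc n) → ℝ≥0∞}
    (hF : Measurable F) : ∫⁻ ρ : stabK n, F (rot (A * (ρ : SO n)) y) ∂(haarK n) =
      ∫⁻ z, F z ∂(sliceProb (rot A (eLast n)) (inner ℝ (eLast n : Euc n) (y : Euc n))) := by
  rw [← map_haarK, lintegral_map hF (continuous_rot_left A y).measurable]

theorem integral_rot_haarK {E : Type*} [NormedAddCommGroup E] [NormedSpace ℝ E]
    (A : SO n) (y : UnitSphere (Euc n)) {F : UnitSphere (Euc n) → E}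
    (hF : StronglyMeasurable F) : ∫ ρ : stabK n, F (rot (A * (ρ : SO n)) y) ∂(haarK n) =
      ∫ z, F z ∂(sliceProb (rot A (eLast n)) (inner ℝ (eLast n : Euc n) (y : Euc n))) := by
  rw [← map_haarK, integral_map (continuous_rot_left A y).measurable.aemeasurable
    hF.aestronglyMeasurable]

/-- Integration over the sphere by slices orthogonal to `x`. -/
theorem lintegral_sphere_eq_slices (x : UnitSphere (Euc n)) {F : UnitSphere (Euc n) → ℝ≥0∞}
    (hF : Measurable F) :
    ∫⁻ y, F y ∂(sphereMeasure (Euc n)) = ENNReal.ofReal (sphereArea (n - 2)) *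
      ∫⁻ s in Ioo (-1 : ℝ) 1, ENNReal.ofReal ((1 - s ^ 2) ^ ((((n - 2 : ℕ) : ℝ) - 1) / 2)) *
        ∫⁻ y, F y ∂(sliceProb x s) := by
  obtain ⟨A, rfl⟩ := exists_rot_eq x
  have hfr : Module.finrank ℝ (Euc n) = (n - 2) + 2 := by
    have := hn.out
    simp
    omega
  have hm : Measurable fun p : stabK n × UnitSphere (Euc n) => F (rot (A * (p.1 : SO n)) p.2) :=
    hF.comp (continuous_rot_rot A).measurable
  -- The weighted integral of slice means is the integral over $y$ of the $K$-average of $F(A\rho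
  -- y)$. After swapping, each rotation $A\rho$ preserves the surface measure.
  rw [← lintegral_inner_sphere hfr (eLast n) (measurable_lintegral_sliceProb _ hF)]
  simp_rw [← lintegral_rot_haarK A _ hF]
  rw [← lintegral_lintegral_swap hm.aemeasurable]
  simp_rw [fun ρ : stabK n => (measurePreserving_rot (A * (ρ : SO n))).lintegral_comp hF]
  simp

theorem exists_inner_eq {t : ℝ} (ht : t ^ 2 ≤ 1) :
    ∃ v : UnitSphere (Euc n), inner ℝ (eLast n : Euc n) (v : Euc n) = t := by
  have : Nontrivial (Submodule.span ℝ {(eLast n : Euc n)})ᗮ :=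
    Module.nontrivial_of_finrank_pos (R := ℝ) (by rw [finrank_orthogonal_span]; omega)
  obtain ⟨u, hu⟩ := (NormedSpace.sphere_nonempty (E := (Submodule.span ℝ {(eLast n : Euc n)})ᗮ)
    (x := 0) (r := 1)).2 zero_le_one
  exact ⟨sliceMap (eLast n) t ⟨u, hu⟩, inner_sliceMap _ ht _⟩

theorem continuous_rot_mul (y : UnitSphere (Euc n)) :
    Continuous fun p : SO n × stabK n => rot (p.1 * (p.2 : SO n)) y :=
  Continuous.comp (g := fun p : SO n × UnitSphere (Euc n) => rot p.1 p.2)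
    (f := fun p : SO n × stabK n => (p.1 * (p.2 : SO n), y)) continuous_rot
    ((continuous_fst.mul (continuous_subtype_val.comp continuous_snd)).prodMk continuous_const)

/-- The parametrization of a slice lives on the sphere of $x^\perp$, which varies with $x$. Pulled
back along $A\mapsto Ae_n$, the slice mean is an integral over the fixed group $K$, jointly
measurable in $A$. -/
theorem measurable_lintegral_sliceProb_left {t : ℝ} (ht : t ^ 2 ≤ 1)
    {F : UnitSphere (Euc n) → ℝ≥0∞} (hF : Measurable F) :
    Measurable fun x => ∫⁻ y, F y ∂(sliceProb x t) := by
  obtain ⟨v, rfl⟩ := exists_inner_eq (n := n) ht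
  refine (Measurable.measurable_comp_iff_of_surjective
    (continuous_rot_apply (eLast n)).measurable exists_rot_eq).1 ?_
  simp_rw [Function.comp_def, ← lintegral_rot_haarK _ v hF]
  exact (hF.comp (continuous_rot_mul v).measurable).lintegral_prod_right'

theorem stronglyMeasurable_integral_sliceProb_left {E : Type*} [NormedAddCommGroup E]
    [NormedSpace ℝ E] [SecondCountableTopology E] {t : ℝ} (ht : t ^ 2 ≤ 1)
    {F : UnitSphere (Euc n) → E} (hF : StronglyMeasurable F) :
    StronglyMeasurable fun x => ∫ y, F y ∂(sliceProb x t) := by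
  borelize E
  obtain ⟨v, rfl⟩ := exists_inner_eq (n := n) ht
  refine ((Measurable.measurable_comp_iff_of_surjective
    (continuous_rot_apply (eLast n)).measurable exists_rot_eq).1 ?_).stronglyMeasurable
  simp_rw [Function.comp_def, ← integral_rot_haarK _ v hF]
  exact ((hF.comp_measurable (continuous_rot_mul v).measurable).integral_prod_right').measurable

/-- The slice averages preserve the integral over the sphere. -/
theorem lintegral_lintegral_sliceProb {t : ℝ} (ht : t ^ 2 ≤ 1)
    {F : UnitSphere (Euc n) → ℝ≥0∞} (hF : Measurable F) :
    ∫⁻ x, ∫⁻ y, F y ∂(sliceProb x t) ∂(sphereMeasure (Euc n)) =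
      ∫⁻ y, F y ∂(sphereMeasure (Euc n)) := by
  have hm := measurable_lintegral_sliceProb_left ht hF
  obtain ⟨v, rfl⟩ := exists_inner_eq (n := n) ht
  -- Both sides become Haar integrals over $SO(n)$. The inner average over $K$ is then absorbed by
  -- right invariance.
  have horb := fun {G : UnitSphere (Euc n) → ℝ≥0∞} (y : UnitSphere (Euc n)) (hy) =>
    lintegral_orbit (haarSO n) (sphereMeasure (Euc n)) (a := rot) (x₀ := y) (F := G)
      continuous_rot.measurable rot_mul measurePreserving_rot hy
  have htr : ∀ y z : UnitSphere (Euc n), ∃ A : SO n, rot A y = z := by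
    intro y z
    obtain ⟨A, rfl⟩ := exists_rot_eq y
    obtain ⟨B, rfl⟩ := exists_rot_eq z
    exact ⟨B * A⁻¹, by rw [← rot_mul, inv_mul_cancel_right]⟩
  rw [horb (eLast n) (htr _) hm, horb v (htr _) hF]
  congr 1
  simp_rw [← lintegral_rot_haarK _ v hF]
  have hj : Measurable (Function.uncurry fun (A : SO n) (ρ : stabK n) =>
      F (rot (A * (ρ : SO n)) v)) := hF.comp (continuous_rot_mul v).measurable
  rw [lintegral_lintegral_swap hj.aemeasurable]
  have : ∀ ρ : stabK n, ∫⁻ A : SO n, F (rot (A * (ρ : SO n)) v) ∂(haarSO n) =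
      ∫⁻ A : SO n, F (rot A v) ∂(haarSO n) := fun ρ =>
    lintegral_mul_right_eq_self (fun A => F (rot A v)) (ρ : SO n)
  simp_rw [this]
  simp

end Slices

/-! ### The generalized dual transform of the Minkowski-Funk transform -/

section Dual

variable {n : ℕ}

theorem injective_sphereMap {V V' : Type*} [NormedAddCommGroup V] [InnerProductSpace ℝ V]
    [NormedAddCommGroup V'] [InnerProductSpace ℝ V'] (L : V ≃ₗᵢ[ℝ] V') :
    Function.Injective (sphereMap L) := fun _ _ h =>
  Subtype.ext (L.injective (congrArg Subtype.val h))

theorem funk_rotate {𝕜 : Type*} [RCLike 𝕜] (f : UnitSphere (Euc n) → 𝕜) (A : SO n)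
    (ξ : Geodesic n) : funk f (ξ.rotate A) =
      ∫ u : UnitSphere ξ.1, f (rot A (perpPoint u)) ∂(sphereMeasure ξ.1) := by
  set L : ξ.1 ≃ₗᵢ[ℝ] (ξ.rotate A).1 :=
    ⟨A.toLinearEquiv.ofSubmodules _ _ rfl, fun v => A.norm_toLinearEquiv v⟩ with hL
  rw [funk, ← (measurePreserving_sphereMap L).integral_comp
    ((continuous_sphereMap L).measurableEmbedding (injective_sphereMap L))]
  rfl

variable [hn : Fact (3 ≤ n)]

/-- The basis vector `e_k`, `k ≠ n`, in the unit sphere of `e_n^⊥`. -/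
def perpBasis (k : {k : Fin n // k ≠ lastIdx n}) :
    UnitSphere (Submodule.span ℝ {(eLast n : Euc n)})ᗮ :=
  ⟨⟨EuclideanSpace.single k.1 1, by
    rw [Submodule.mem_orthogonal_singleton_iff_inner_right]
    simp [eLast, EuclideanSpace.inner_single_left, k.2.symm]⟩, by simp⟩

/-- The inverse is the transpose, so the $e_n$-coordinate pairs $u$ with the last column of the
plane matrix. Its entry at $k$ is $\cos\theta$, and its entry at $n$ meets $u_n=0$. -/
theorem inner_rot_planeRotation_inv (k : {k : Fin n // k ≠ lastIdx n}) (θ : ℝ)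
    (u : UnitSphere (Submodule.span ℝ {(eLast n : Euc n)})ᗮ) :
    inner ℝ (eLast n : Euc n) (rot (planeRotation k θ)⁻¹ (perpPoint u) : Euc n) =
      Real.cos θ * inner ℝ (perpBasis k : (Submodule.span ℝ {(eLast n : Euc n)})ᗮ)
        (u : (Submodule.span ℝ {(eLast n : Euc n)})ᗮ) := by
  have h0 : inner ℝ (eLast n : Euc n)
      ((u : (Submodule.span ℝ {(eLast n : Euc n)})ᗮ) : Euc n) = 0 :=
    Submodule.mem_orthogonal_singleton_iff_inner_right.1 u.1.2
  rw [Submodule.coe_inner, coe_rot]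
  change inner ℝ (EuclideanSpace.single (lastIdx n) (1 : ℝ))
    (Matrix.toEuclideanLin ((planeRotation k θ)⁻¹ : SO n).1
      ((u : (Submodule.span ℝ {(eLast n : Euc n)})ᗮ) : Euc n)) =
    Real.cos θ * inner ℝ (EuclideanSpace.single k.1 (1 : ℝ)) _
  set w : Euc n := ((u : (Submodule.span ℝ {(eLast n : Euc n)})ᗮ) : Euc n)
  have hw : w (lastIdx n) = 0 := by
    simpa [eLast, EuclideanSpace.inner_single_left] using h0
  rw [SO.coe_inv]
  simp only [EuclideanSpace.inner_single_left, Matrix.toLpLin_apply]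
  simp only [map_one, one_mul, Matrix.mulVec, dotProduct, Matrix.transpose_apply, planeRotation,
    planeMatrix, Matrix.of_apply]
  rw [Finset.sum_eq_single k.1]
  · simp [k.2.symm]
  · intro i _ hi
    by_cases hl : i = lastIdx n
    · subst hl; simp [hw]
    · simp [hi, hl]
  · simp

theorem finrank_orthogonal_span_eLast :
    Module.finrank ℝ (Submodule.span ℝ {(eLast n : Euc n)})ᗮ = (n - 3) + 2 := by
  rw [finrank_orthogonal_span]
  have := hn.out
  omega

theorem continuous_rot_mul_perpPoint (A B : SO n) :
    Continuous fun p : stabK n × UnitSphere (Submodule.span ℝ {(eLast n : Euc n)})ᗮ =>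
      rot (A * (p.1 : SO n) * B) (perpPoint p.2) :=
  Continuous.comp (g := fun p : SO n × UnitSphere (Euc n) => rot p.1 p.2)
    (f := fun p : stabK n × UnitSphere (Submodule.span ℝ {(eLast n : Euc n)})ᗮ =>
      (A * (p.1 : SO n) * B, perpPoint p.2)) continuous_rot
    (((continuous_const.mul (continuous_subtype_val.comp continuous_fst)).mul
      continuous_const).prodMk (continuous_perpPoint.comp continuous_snd))

theorem dualFunk_funk {𝕜 : Type*} [RCLike 𝕜] (f : UnitSphere (Euc n) → 𝕜)
    (k : {k : Fin n // k ≠ lastIdx n}) (θ : ℝ) (x : UnitSphere (Euc n)) :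
    dualFunk k θ (funk f) x = ∫ ρ : stabK n, ∫ u,
      f (rot (rotationTo x * (ρ : SO n) * (planeRotation k θ)⁻¹) (perpPoint u))
        ∂(sphereMeasure (Submodule.span ℝ {(eLast n : Euc n)})ᗮ) ∂(haarK n) := by
  simp_rw [dualFunk, funk_rotate]
  rfl

/-- For fixed $u$ the $K$-average is a slice mean at height $\cos\theta\,u_k$, a zonal function of
$u$ on the unit sphere of the $(n-1)$-dimensional $e_n^\perp$. This Tonelli form controls both
integrability and null sets. -/
theorem lintegral_dual (k : {k : Fin n // k ≠ lastIdx n}) (θ : ℝ) (x : UnitSphere (Euc n))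
    {F : UnitSphere (Euc n) → ℝ≥0∞} (hF : Measurable F) :
    ∫⁻ p : stabK n × UnitSphere (Submodule.span ℝ {(eLast n : Euc n)})ᗮ,
      F (rot (rotationTo x * (p.1 : SO n) * (planeRotation k θ)⁻¹) (perpPoint p.2))
        ∂((haarK n).prod (sphereMeasure (Submodule.span ℝ {(eLast n : Euc n)})ᗮ)) =
      ENNReal.ofReal (sphereArea (n - 3)) * ∫⁻ s in Ioo (-1 : ℝ) 1,
        ENNReal.ofReal ((1 - s ^ 2) ^ ((((n - 3 : ℕ) : ℝ) - 1) / 2)) *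
          ∫⁻ y, F y ∂(sliceProb x (Real.cos θ * s)) := by
  have hm : Measurable fun s : ℝ => ∫⁻ y, F y ∂(sliceProb x (Real.cos θ * s)) :=
    (measurable_lintegral_sliceProb x hF).comp (measurable_const_mul _)
  have hj : Measurable fun p : stabK n × UnitSphere (Submodule.span ℝ {(eLast n : Euc n)})ᗮ =>
      F (rot (rotationTo x * (p.1 : SO n) * (planeRotation k θ)⁻¹) (perpPoint p.2)) :=
    hF.comp (continuous_rot_mul_perpPoint _ _).measurable
  rw [lintegral_prod_symm _ hj.aemeasurable,
    ← lintegral_inner_sphere finrank_orthogonal_span_eLast (perpBasis k) hm]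
  refine lintegral_congr fun u => ?_
  rw [← inner_rot_planeRotation_inv k θ u]
  have := lintegral_rot_haarK (rotationTo x) (rot (planeRotation k θ)⁻¹ (perpPoint u)) hF
  rw [rot_rotationTo] at this
  simpa only [rot_mul] using this

theorem dualFunk_funk_eq_integral {𝕜 : Type*} [RCLike 𝕜] {f : UnitSphere (Euc n) → 𝕜}
    (hf : StronglyMeasurable f) (k : {k : Fin n // k ≠ lastIdx n}) (θ : ℝ)
    (x : UnitSphere (Euc n))
    (hfin : ∫⁻ s in Ioo (-1 : ℝ) 1,
        ENNReal.ofReal ((1 - s ^ 2) ^ ((((n - 3 : ℕ) : ℝ) - 1) / 2)) *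
          ∫⁻ y, ‖f y‖ₑ ∂(sliceProb x (Real.cos θ * s)) ≠ ⊤) :
    dualFunk k θ (funk f) x = sphereArea (n - 3) • ∫ s in Ioo (-1 : ℝ) 1,
      (1 - s ^ 2) ^ ((((n - 3 : ℕ) : ℝ) - 1) / 2) • ∫ y, f y ∂(sliceProb x (Real.cos θ * s)) := by
  have hm : StronglyMeasurable fun s : ℝ => ∫ y, f y ∂(sliceProb x (Real.cos θ * s)) :=
    (stronglyMeasurable_integral_sliceProb x hf).comp_measurable (measurable_const_mul _)
  have hint : Integrable (Function.uncurry fun (ρ : stabK n)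
      (u : UnitSphere (Submodule.span ℝ {(eLast n : Euc n)})ᗮ) =>
      f (rot (rotationTo x * (ρ : SO n) * (planeRotation k θ)⁻¹) (perpPoint u)))
      ((haarK n).prod (sphereMeasure (Submodule.span ℝ {(eLast n : Euc n)})ᗮ)) := by
    refine ⟨(hf.comp_measurable
      (continuous_rot_mul_perpPoint _ _).measurable).aestronglyMeasurable, ?_⟩
    rw [hasFiniteIntegral_iff_enorm]
    refine lt_of_eq_of_lt (lintegral_dual k θ x hf.enorm) ?_
    exact ENNReal.mul_lt_top ENNReal.ofReal_lt_top hfin.lt_top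
  rw [dualFunk_funk, integral_integral_swap hint,
    ← integral_inner_sphere finrank_orthogonal_span_eLast (perpBasis k) hm]
  refine integral_congr_ae (Eventually.of_forall fun u => ?_)
  dsimp only
  rw [← inner_rot_planeRotation_inv k θ u]
  have := integral_rot_haarK (rotationTo x) (rot (planeRotation k θ)⁻¹ (perpPoint u)) hf
  rw [rot_rotationTo] at this
  simpa only [rot_mul] using this

/-! ### Null sets -/

/-- Slicing the sphere around the given $x$ with a weight positive on $(-1,1)$; no exceptional set
of $x$ arises. -/
theorem ae_ae_sliceProb (x : UnitSphere (Euc n)) {p : UnitSphere (Euc n) → Prop}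
    (hp : ∀ᵐ y ∂(sphereMeasure (Euc n)), p y) :
    ∀ᵐ s ∂(volume.restrict (Ioo (-1 : ℝ) 1)), ∀ᵐ y ∂(sliceProb x s), p y := by
  obtain ⟨N, hpN, hN, hN0⟩ := exists_measurable_superset_of_null (ae_iff.1 hp)
  have h := lintegral_sphere_eq_slices x (F := N.indicator 1) (measurable_one.indicator hN)
  rw [lintegral_indicator_one hN, hN0, eq_comm, mul_eq_zero] at h
  have h := h.resolve_left (by simpa using sphereArea_pos (n - 2))
  have hm := measurable_lintegral_sliceProb x (F := N.indicator 1) (measurable_one.indicator hN)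
  rw [lintegral_eq_zero_iff (by fun_prop)] at h
  filter_upwards [h, ae_restrict_mem measurableSet_Ioo] with s hs hs'
  have h1 : 0 < 1 - s ^ 2 := by nlinarith [hs'.1, hs'.2]
  rw [Pi.zero_apply, mul_eq_zero, lintegral_indicator_one hN] at hs
  have hs := hs.resolve_left (by simpa using Real.rpow_pos_of_pos h1 _)
  exact measure_mono_null hpN hs

/-- A nonzero dilation preserves null sets. For $c=0$ it would collapse everything onto the single
height $0$, where $p$ may fail. -/
theorem ae_restrict_mul_left {c : ℝ} (hc : c ∈ Ioo (0 : ℝ) 1) {p : ℝ → Prop}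
    (hp : ∀ᵐ s ∂(volume.restrict (Ioo (-1 : ℝ) 1)), p s) :
    ∀ᵐ s ∂(volume.restrict (Ioo (-1 : ℝ) 1)), p (c * s) := by
  rw [ae_restrict_iff' measurableSet_Ioo] at hp ⊢
  filter_upwards [(Measure.quasiMeasurePreserving_smul volume hc.1.ne').ae hp] with s hs hs'
  exact hs ⟨by simp only [smul_eq_mul]; nlinarith [hs'.1, hc.1, hc.2],
    by simp only [smul_eq_mul]; nlinarith [hs'.2, hc.1, hc.2]⟩

/-- A property of almost every point holds almost everywhere with respect to the measure that
underlies the composition of the two transforms. -/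
theorem ae_dual (k : {k : Fin n // k ≠ lastIdx n}) {θ : ℝ} (hθ : Real.cos θ ∈ Ioo (0 : ℝ) 1)
    (x : UnitSphere (Euc n)) {p : UnitSphere (Euc n) → Prop}
    (hp : ∀ᵐ y ∂(sphereMeasure (Euc n)), p y) :
    ∀ᵐ ρ : stabK n ∂(haarK n), ∀ᵐ u ∂(sphereMeasure (Submodule.span ℝ {(eLast n : Euc n)})ᗮ),
      p (rot (rotationTo x * (ρ : SO n) * (planeRotation k θ)⁻¹) (perpPoint u)) := by
  obtain ⟨N, hpN, hN, hN0⟩ := exists_measurable_superset_of_null (ae_iff.1 hp)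
  have hpN' : ∀ᵐ y ∂(sphereMeasure (Euc n)), y ∉ N := measure_eq_zero_iff_ae_notMem.1 hN0
  have h := lintegral_dual k θ x (F := N.indicator 1) (measurable_one.indicator hN)
  have h0 := ae_restrict_mul_left hθ (ae_ae_sliceProb x hpN')
  have h1 : ∫⁻ s in Ioo (-1 : ℝ) 1,
      ENNReal.ofReal ((1 - s ^ 2) ^ ((((n - 3 : ℕ) : ℝ) - 1) / 2)) *
        ∫⁻ y, N.indicator 1 y ∂(sliceProb x (Real.cos θ * s)) = 0 := by
    refine lintegral_eq_zero_of_ae_eq_zero ?_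
    filter_upwards [h0] with s hs
    rw [lintegral_indicator_one hN, measure_eq_zero_iff_ae_notMem.2 hs, mul_zero]
    rfl
  rw [h1, mul_zero, lintegral_eq_zero_iff] at h
  · have h := Measure.ae_ae_of_ae_prod h
    filter_upwards [h] with ρ hρ
    filter_upwards [hρ] with u hu
    by_contra hc
    have : rot (rotationTo x * (ρ : SO n) * (planeRotation k θ)⁻¹) (perpPoint u) ∈ N := hpN hc
    simp [this] at hu
  · exact (measurable_one.indicator hN).comp (continuous_rot_mul_perpPoint _ _).measurable

end Dual

/-! ### Riemann-Liouville integrals -/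

section Beta

/-- The integrand is the absolute value of the complex beta integrand. -/
theorem integrableOn_beta {a b : ℝ} (ha : 0 < a) (hb : 0 < b) :
    IntegrableOn (fun v : ℝ => (1 - v) ^ (b - 1) * v ^ (a - 1)) (Ioo 0 1) := by
  have h := Complex.betaIntegral_convergent (u := a) (v := b) (by simpa) (by simpa)
  rw [intervalIntegrable_iff_integrableOn_Ioo_of_le zero_le_one] at h
  refine h.norm.congr ?_
  filter_upwards [ae_restrict_mem measurableSet_Ioo] with v hv
  have h1 : 0 < 1 - v := sub_pos.2 hv.2
  have h2 : (1 : ℂ) - v = ((1 - v : ℝ) : ℂ) := by push_cast; rfl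
  rw [norm_mul, h2, Complex.norm_cpow_eq_rpow_re_of_pos hv.1,
    Complex.norm_cpow_eq_rpow_re_of_pos h1, mul_comm]
  simp

/-- The beta integral. -/
def betaConst (a b : ℝ) : ℝ := ∫ v in Ioo (0 : ℝ) 1, (1 - v) ^ (b - 1) * v ^ (a - 1)

theorem betaConst_pos {a b : ℝ} (ha : 0 < a) (hb : 0 < b) : 0 < betaConst a b := by
  have hpos : ∀ v ∈ Ioo (0 : ℝ) 1, 0 < (1 - v) ^ (b - 1) * v ^ (a - 1) := fun v hv =>
    mul_pos (Real.rpow_pos_of_pos (sub_pos.2 hv.2) _) (Real.rpow_pos_of_pos hv.1 _)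
  refine (setIntegral_pos_iff_support_of_nonneg_ae ?_ (integrableOn_beta ha hb)).2 ?_
  · filter_upwards [ae_restrict_mem measurableSet_Ioo] with v hv using (hpos v hv).le
  · refine lt_of_lt_of_le (b := volume (Ioo (0 : ℝ) 1)) (by simp) (measure_mono fun v hv => ?_)
    exact ⟨(hpos v hv).ne', hv⟩

theorem image_affine_Ioo {τ t : ℝ} (h : τ < t) :
    (fun v => τ + (t - τ) * v) '' Ioo 0 1 = Ioo τ t := by
  have h0 : 0 < t - τ := sub_pos.2 h
  ext s
  constructor
  · rintro ⟨v, hv, rfl⟩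
    exact ⟨by nlinarith [hv.1], by nlinarith [hv.2]⟩
  · intro hs
    refine ⟨(s - τ) / (t - τ), ⟨div_pos (sub_pos.2 hs.1) h0, (div_lt_one h0).2 ?_⟩, ?_⟩
    · linarith [hs.2]
    · field_simp
      ring

theorem hasDerivWithinAt_affine (τ c : ℝ) (S : Set ℝ) (v : ℝ) :
    HasDerivWithinAt (fun v => τ + c * v) c S v := by
  simpa using (((hasDerivAt_id' v).const_mul c).const_add τ).hasDerivWithinAt

theorem beta_kernel_aux {a b τ t v : ℝ} (h : τ < t) (hv : v ∈ Ioo (0 : ℝ) 1) :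
    |t - τ| • ((t - (τ + (t - τ) * v)) ^ (b - 1) * (τ + (t - τ) * v - τ) ^ (a - 1)) =
      (t - τ) ^ (a + b - 1) * ((1 - v) ^ (b - 1) * v ^ (a - 1)) := by
  have h0 : 0 < t - τ := sub_pos.2 h
  rw [show t - (τ + (t - τ) * v) = (t - τ) * (1 - v) by ring,
    show τ + (t - τ) * v - τ = (t - τ) * v by ring, Real.mul_rpow h0.le (sub_pos.2 hv.2).le,
    Real.mul_rpow h0.le hv.1.le, abs_of_pos h0, smul_eq_mul,
    show a + b - 1 = 1 + (b - 1) + (a - 1) by ring, Real.rpow_add h0, Real.rpow_add h0,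
    Real.rpow_one]
  ring

theorem integrableOn_beta_kernel {a b τ t : ℝ} (ha : 0 < a) (hb : 0 < b) (h : τ < t) :
    IntegrableOn (fun s : ℝ => (t - s) ^ (b - 1) * (s - τ) ^ (a - 1)) (Ioo τ t) := by
  have h0 : 0 < t - τ := sub_pos.2 h
  rw [← image_affine_Ioo h, integrableOn_image_iff_integrableOn_abs_deriv_smul measurableSet_Ioo
    (fun v _ => hasDerivWithinAt_affine τ (t - τ) _ v)
    (fun v _ w _ hvw => by simpa [h0.ne'] using hvw)]
  refine ((integrableOn_beta ha hb).const_mul ((t - τ) ^ (a + b - 1))).congr ?_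
  filter_upwards [ae_restrict_mem measurableSet_Ioo] with v hv
  exact (beta_kernel_aux h hv).symm

theorem integral_beta_kernel {a b τ t : ℝ} (h : τ < t) :
    ∫ s in Ioo τ t, (t - s) ^ (b - 1) * (s - τ) ^ (a - 1) =
      (t - τ) ^ (a + b - 1) * betaConst a b := by
  have h0 : 0 < t - τ := sub_pos.2 h
  rw [betaConst, ← integral_const_mul]
  rw [← image_affine_Ioo h, integral_image_eq_integral_abs_deriv_smul measurableSet_Ioo
    (fun v _ => hasDerivWithinAt_affine τ (t - τ) _ v)
    (fun v _ w _ hvw => by simpa [h0.ne'] using hvw)]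
  exact setIntegral_congr_fun measurableSet_Ioo fun v hv => beta_kernel_aux h hv

end Beta

/-! ### Fractional integrals on $(0,1)$: convergence, composition, injectivity. -/

section RiemannLiouville

/-- The points $1-1/(m+2)$ give a countable exhaustion of $(0,1)$, to pass from integrability on
each $(0,a)$ to statements on $(0,1)$. The shift by $2$ keeps the first one positive. -/
theorem one_sub_one_div_mem (m : ℕ) : 1 - 1 / ((m : ℝ) + 2) ∈ Ioo (0 : ℝ) 1 := by
  have h : (0 : ℝ) < 1 / ((m : ℝ) + 2) := by positivity
  refine ⟨?_, by linarith⟩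
  rw [sub_pos, div_lt_one (by positivity)]
  linarith [(Nat.cast_nonneg m : (0 : ℝ) ≤ m)]

theorem exists_lt_one_sub_one_div {t : ℝ} (ht : t < 1) : ∃ m : ℕ, t < 1 - 1 / ((m : ℝ) + 2) := by
  obtain ⟨m, hm⟩ := exists_nat_one_div_lt (sub_pos.2 ht)
  have : 1 / ((m : ℝ) + 2) ≤ 1 / ((m : ℝ) + 1) :=
    one_div_le_one_div_of_le (by positivity) (by linarith)
  exact ⟨m, by linarith⟩

theorem iUnion_Ioo_one_sub : ⋃ m : ℕ, Ioo (0 : ℝ) (1 - 1 / ((m : ℝ) + 2)) = Ioo 0 1 := by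
  ext t
  simp only [mem_iUnion]
  constructor
  · rintro ⟨m, hm⟩
    exact ⟨hm.1, hm.2.trans (one_sub_one_div_mem m).2⟩
  · intro ht
    obtain ⟨m, hm⟩ := exists_lt_one_sub_one_div ht.2
    exact ⟨m, ht.1, hm⟩

/-- Almost every Riemann-Liouville integral of a locally integrable function converges. -/
theorem ae_lintegral_rl_lt_top {α : ℝ} (hα : 0 < α) {ψ : ℝ → ℝ≥0∞} (hψ : Measurable ψ)
    (hfin : ∀ a ∈ Ioo (0 : ℝ) 1, ∫⁻ τ in Ioo 0 a, ψ τ ≠ ⊤) :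
    ∀ᵐ t ∂(volume.restrict (Ioo (0 : ℝ) 1)),
      ∫⁻ τ in Ioo 0 t, ENNReal.ofReal ((t - τ) ^ (α - 1)) * ψ τ < ⊤ := by
  -- The kernel cut off to $(0,1)$ is integrable since $\alpha>0$. Its convolution with an
  -- integrable function is therefore finite almost everywhere.
  set κ : ℝ → ℝ≥0∞ := (Ioo (0 : ℝ) 1).indicator fun u => ENNReal.ofReal (u ^ (α - 1)) with hκ
  have hκm : Measurable κ := (by fun_prop : Measurable _).indicator measurableSet_Ioo
  have hκfin : ∫⁻ u, κ u ≠ ⊤ := by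
    rw [hκ, lintegral_indicator measurableSet_Ioo]
    have h := (intervalIntegral.integrableOn_Ioo_rpow_iff (s := α - 1) zero_lt_one).2 (by linarith)
    exact ((hasFiniteIntegral_iff_ofReal (by
      filter_upwards [ae_restrict_mem measurableSet_Ioo] with v hv
      exact Real.rpow_nonneg hv.1.le _)).1 h.2).ne
  have key : ∀ a ∈ Ioo (0 : ℝ) 1, ∀ᵐ t, ∫⁻ τ, κ (t - τ) * (Ioo 0 a).indicator ψ τ < ⊤ := by
    intro a ha
    have hψa : Measurable ((Ioo 0 a).indicator ψ) := hψ.indicator measurableSet_Ioo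
    refine ae_lt_top (Measurable.lintegral_prod_right' (f := fun p : ℝ × ℝ =>
      κ (p.1 - p.2) * (Ioo 0 a).indicator ψ p.2) (by fun_prop)) ?_
    rw [lintegral_lintegral_swap (by fun_prop)]
    have h1 : ∀ τ, ∫⁻ t, κ (t - τ) * (Ioo 0 a).indicator ψ τ =
        (∫⁻ u, κ u) * (Ioo 0 a).indicator ψ τ := by
      intro τ
      rw [lintegral_mul_const _ (by fun_prop), lintegral_sub_right_eq_self (fun u => κ u)]
    simp_rw [h1]
    rw [lintegral_const_mul _ hψa]
    refine ENNReal.mul_ne_top hκfin ?_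
    rw [lintegral_indicator measurableSet_Ioo]
    exact hfin a ha
  have key' : ∀ᵐ t, ∀ m : ℕ, ∫⁻ τ, κ (t - τ) *
      (Ioo 0 (1 - 1 / ((m : ℝ) + 2))).indicator ψ τ < ⊤ := by
    exact ae_all_iff.2 fun m => key _ (one_sub_one_div_mem m)
  filter_upwards [ae_restrict_of_ae key', ae_restrict_mem measurableSet_Ioo] with t ht ht'
  obtain ⟨m, hm'⟩ := exists_lt_one_sub_one_div ht'.2
  refine lt_of_le_of_lt ?_ (ht m)
  rw [← lintegral_indicator measurableSet_Ioo]
  refine lintegral_mono fun τ => ?_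
  by_cases hτ : τ ∈ Ioo 0 t
  · have h1 : t - τ ∈ Ioo (0 : ℝ) 1 := ⟨sub_pos.2 hτ.2, by linarith [hτ.1, ht'.2]⟩
    have h2 : τ ∈ Ioo 0 (1 - 1 / ((m : ℝ) + 2)) := ⟨hτ.1, hτ.2.trans hm'⟩
    rw [indicator_of_mem hτ, indicator_of_mem h2, hκ, indicator_of_mem h1]
  · rw [indicator_of_notMem hτ]
    exact zero_le

variable {E : Type*} [NormedAddCommGroup E] [NormedSpace ℝ E]

theorem ae_integrableOn_rl {α : ℝ} (hα : 0 < α) {ψ : ℝ → E}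
    (hψ : ∀ a ∈ Ioo (0 : ℝ) 1, IntegrableOn ψ (Ioo 0 a)) :
    ∀ᵐ t ∂(volume.restrict (Ioo (0 : ℝ) 1)),
      IntegrableOn (fun τ => (t - τ) ^ (α - 1) • ψ τ) (Ioo 0 t) := by
  have hm : AEStronglyMeasurable ψ (volume.restrict (Ioo (0 : ℝ) 1)) := by
    rw [← iUnion_Ioo_one_sub]
    exact aestronglyMeasurable_iUnion_iff.2 fun m =>
      (hψ _ (one_sub_one_div_mem m)).aestronglyMeasurable
  obtain ⟨φ, hφm, hφ⟩ := hm
  have hsub : ∀ a ≤ (1 : ℝ), ψ =ᵐ[volume.restrict (Ioo 0 a)] φ := fun a ha =>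
    ae_restrict_of_ae_restrict_of_subset (Ioo_subset_Ioo_right ha) hφ
  have h := ae_lintegral_rl_lt_top hα hφm.enorm (fun a ha => by
    have := ((hψ a ha).congr (hsub a ha.2.le)).2
    rw [hasFiniteIntegral_iff_enorm] at this
    exact this.ne)
  filter_upwards [h, ae_restrict_mem measurableSet_Ioo] with t ht ht'
  have hφt : IntegrableOn (fun τ => (t - τ) ^ (α - 1) • φ τ) (Ioo 0 t) := by
    refine ⟨(by fun_prop : Measurable fun τ : ℝ => (t - τ) ^ (α - 1)).aestronglyMeasurable.smul
      hφm.aestronglyMeasurable, ?_⟩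
    rw [hasFiniteIntegral_iff_enorm]
    refine lt_of_eq_of_lt (setLIntegral_congr_fun measurableSet_Ioo fun τ hτ => ?_) ht
    simp only [enorm_smul]
    rw [Real.enorm_of_nonneg (Real.rpow_nonneg (sub_pos.2 hτ.2).le _)]
  refine hφt.congr ?_
  filter_upwards [hsub t ht'.2.le] with τ hτ
  rw [hτ]

/-- The kernel of a composition of two Riemann-Liouville integrals is integrable. -/
theorem integrable_rl_kernel {a b t : ℝ} (ha : 0 < a) (hb : 0 < b) (hab : 1 ≤ a + b)
    {ψ : ℝ → E} (hψ : IntegrableOn ψ (Ioo 0 t)) :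
    Integrable (fun p : ℝ × ℝ =>
      (Ioo p.2 t).indicator (fun s => (t - s) ^ (b - 1) * (s - p.2) ^ (a - 1)) p.1 • ψ p.2)
      ((volume.restrict (Ioo 0 t)).prod (volume.restrict (Ioo 0 t))) := by
  have hK : Measurable fun p : ℝ × ℝ =>
      (Ioo p.2 t).indicator (fun s => (t - s) ^ (b - 1) * (s - p.2) ^ (a - 1)) p.1 := by
    have : (fun p : ℝ × ℝ =>
        (Ioo p.2 t).indicator (fun s => (t - s) ^ (b - 1) * (s - p.2) ^ (a - 1)) p.1) =
        {p : ℝ × ℝ | p.2 < p.1 ∧ p.1 < t}.indicator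
          fun p => (t - p.1) ^ (b - 1) * (p.1 - p.2) ^ (a - 1) := by
      ext p
      simp [indicator_apply]
    rw [this]
    refine Measurable.indicator (by fun_prop) ?_
    exact (measurableSet_lt measurable_snd measurable_fst).inter
      (measurableSet_lt measurable_fst measurable_const)
  have hKnn : ∀ s τ : ℝ, 0 ≤ (Ioo τ t).indicator
      (fun s => (t - s) ^ (b - 1) * (s - τ) ^ (a - 1)) s := fun s τ =>
    indicator_nonneg (fun s hs => mul_nonneg (Real.rpow_nonneg (sub_pos.2 hs.2).le _)
      (Real.rpow_nonneg (sub_pos.2 hs.1).le _)) _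
  have hm : AEStronglyMeasurable (fun p : ℝ × ℝ =>
      (Ioo p.2 t).indicator (fun s => (t - s) ^ (b - 1) * (s - p.2) ^ (a - 1)) p.1 • ψ p.2)
      ((volume.restrict (Ioo 0 t)).prod (volume.restrict (Ioo 0 t))) :=
    hK.aestronglyMeasurable.smul hψ.aestronglyMeasurable.comp_snd
  rw [integrable_prod_iff' hm]
  have hint : ∀ τ ∈ Ioo 0 t, Integrable (fun s => (Ioo τ t).indicator
      (fun s => (t - s) ^ (b - 1) * (s - τ) ^ (a - 1)) s) (volume.restrict (Ioo 0 t)) := by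
    intro τ hτ
    refine Integrable.integrableOn ?_
    exact (integrable_indicator_iff measurableSet_Ioo).2 (integrableOn_beta_kernel ha hb hτ.2)
  constructor
  · filter_upwards [ae_restrict_mem measurableSet_Ioo] with τ hτ
    exact (hint τ hτ).smul_const _
  · have heq : ∀ᵐ τ ∂(volume.restrict (Ioo 0 t)), ((t - τ) ^ (a + b - 1) * betaConst a b) • ‖ψ τ‖ =
        ∫ s in Ioo 0 t, ‖(Ioo τ t).indicator
          (fun s => (t - s) ^ (b - 1) * (s - τ) ^ (a - 1)) s • ψ τ‖ := by
      filter_upwards [ae_restrict_mem measurableSet_Ioo] with τ hτ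
      simp_rw [norm_smul, Real.norm_of_nonneg (hKnn _ _)]
      rw [integral_mul_const, setIntegral_indicator measurableSet_Ioo,
        inter_eq_right.2 (Ioo_subset_Ioo_left hτ.1.le), integral_beta_kernel hτ.2, smul_eq_mul]
    refine Integrable.congr ?_ heq
    -- Since $a+b\ge 1$, the power $(t-\tau)^{a+b-1}$ is bounded by $t^{a+b-1}$. This is why the
    -- composition formula holds for each $t$ and not only almost everywhere.
    refine Integrable.bdd_smul hψ.norm (t ^ (a + b - 1) * betaConst a b)
      (by fun_prop : Measurable fun τ : ℝ =>
        (t - τ) ^ (a + b - 1) * betaConst a b).aestronglyMeasurable ?_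
    filter_upwards [ae_restrict_mem measurableSet_Ioo] with τ hτ
    have h0 : 0 < t - τ := sub_pos.2 hτ.2
    have hB := (betaConst_pos ha hb).le
    rw [Real.norm_of_nonneg (by positivity)]
    gcongr
    linarith [hτ.1]

theorem integral_rl_kernel_left {a b s t : ℝ} {ψ : ℝ → E} (hs : s ∈ Ioo 0 t) :
    ∫ τ in Ioo 0 t, (Ioo τ t).indicator
      (fun s => (t - s) ^ (b - 1) * (s - τ) ^ (a - 1)) s • ψ τ =
      (t - s) ^ (b - 1) • ∫ τ in Ioo 0 s, (s - τ) ^ (a - 1) • ψ τ := by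
  rw [← integral_smul, ← integral_indicator measurableSet_Ioo,
    ← integral_indicator measurableSet_Ioo]
  congr 1
  ext τ
  by_cases h1 : τ ∈ Ioo 0 s
  · have h2 : τ ∈ Ioo 0 t := ⟨h1.1, h1.2.trans hs.2⟩
    have h3 : s ∈ Ioo τ t := ⟨h1.2, hs.2⟩
    rw [indicator_of_mem h1, indicator_of_mem h2, indicator_of_mem h3, mul_smul]
  · rw [indicator_of_notMem h1]
    by_cases h2 : τ ∈ Ioo 0 t
    · have h3 : s ∉ Ioo τ t := fun h3 => h1 ⟨h2.1, h3.1⟩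
      rw [indicator_of_mem h2, indicator_of_notMem h3, zero_smul]
    · rw [indicator_of_notMem h2]

variable [CompleteSpace E]

/-- The semigroup law without Gamma factors: Fubini on the triangle $\tau<s<t$, with a beta integral
in $s$. -/
theorem integral_rl_comp {a b t : ℝ} (ha : 0 < a) (hb : 0 < b) (hab : 1 ≤ a + b)
    {ψ : ℝ → E} (hψ : IntegrableOn ψ (Ioo 0 t)) :
    ∫ s in Ioo 0 t, (t - s) ^ (b - 1) • ∫ τ in Ioo 0 s, (s - τ) ^ (a - 1) • ψ τ =
      betaConst a b • ∫ τ in Ioo 0 t, (t - τ) ^ (a + b - 1) • ψ τ := by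
  have h := integral_integral_swap (f := fun s τ : ℝ =>
    (Ioo τ t).indicator (fun s => (t - s) ^ (b - 1) * (s - τ) ^ (a - 1)) s • ψ τ)
    (integrable_rl_kernel ha hb hab hψ)
  have hl := fun s (hs : s ∈ Ioo 0 t) => integral_rl_kernel_left (a := a) (b := b) (ψ := ψ) hs
  have hr : ∀ τ ∈ Ioo 0 t, ∫ s in Ioo 0 t, (Ioo τ t).indicator
      (fun s => (t - s) ^ (b - 1) * (s - τ) ^ (a - 1)) s • ψ τ =
      betaConst a b • (t - τ) ^ (a + b - 1) • ψ τ := by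
    intro τ hτ
    rw [integral_smul_const, setIntegral_indicator measurableSet_Ioo,
      inter_eq_right.2 (Ioo_subset_Ioo_left hτ.1.le), integral_beta_kernel hτ.2, mul_comm, mul_smul]
  rw [setIntegral_congr_fun measurableSet_Ioo hl, setIntegral_congr_fun measurableSet_Ioo hr,
    integral_smul] at h
  exact h

/-- A primitive is continuous, so it vanishes everywhere once it does almost everywhere. Lebesgue
differentiation recovers the integrand. -/
theorem ae_eq_zero_of_ae_integral_eq_zero {h : ℝ → E}
    (hh : ∀ a ∈ Ioo (0 : ℝ) 1, IntegrableOn h (Ioo 0 a))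
    (h0 : ∀ᵐ t ∂(volume.restrict (Ioo (0 : ℝ) 1)), ∫ τ in Ioo 0 t, h τ = 0) :
    ∀ᵐ t ∂(volume.restrict (Ioo (0 : ℝ) 1)), h t = 0 := by
  rw [← iUnion_Ioo_one_sub, ae_restrict_iUnion_iff]
  intro m
  obtain ⟨ha0, ha1⟩ := one_sub_one_div_mem m
  set a := 1 - 1 / ((m : ℝ) + 2)
  have hI : IntervalIntegrable h volume 0 a :=
    (intervalIntegrable_iff_integrableOn_Ioo_of_le ha0.le).2 (hh a ⟨ha0, ha1⟩)
  have hF : ∀ t ∈ Ioo 0 a, ∫ τ in Ioo 0 t, h τ = ∫ τ in (0 : ℝ)..t, h τ := fun t ht => by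
    rw [intervalIntegral.integral_of_le ht.1.le, integral_Ioc_eq_integral_Ioo]
  have hc : ContinuousOn (fun t => ∫ τ in (0 : ℝ)..t, h τ) (Ioo 0 a) := by
    have := intervalIntegral.continuousOn_primitive_interval' hI left_mem_uIcc
    exact this.mono (by rw [uIcc_of_le ha0.le]; exact Ioo_subset_Icc_self)
  have hae : (fun t => ∫ τ in (0 : ℝ)..t, h τ) =ᵐ[volume.restrict (Ioo 0 a)] fun _ => 0 := by
    filter_upwards [ae_restrict_of_ae_restrict_of_subset (Ioo_subset_Ioo_right ha1.le) h0,
      ae_restrict_mem measurableSet_Ioo] with t ht ht'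
    rw [← hF t ht', ht]
  have hz := Measure.eqOn_open_of_ae_eq hae isOpen_Ioo hc continuousOn_const
  rw [ae_restrict_iff' measurableSet_Ioo]
  filter_upwards [hI.ae_hasDerivAt_integral] with t ht ht'
  have hd := ht (by rw [uIcc_of_le ha0.le]; exact Ioo_subset_Icc_self ht') 0 left_mem_uIcc
  have hd0 : HasDerivAt (fun t => ∫ τ in (0 : ℝ)..t, h τ) 0 t :=
    (hasDerivAt_const t (0 : E)).congr_of_eventuallyEq
      (hz.eventuallyEq_of_mem (isOpen_Ioo.mem_nhds ht'))
  exact hd.unique hd0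

theorem ae_eq_zero_of_ae_integral_pow_eq_zero (N : ℕ) {ψ : ℝ → E}
    (hψ : ∀ a ∈ Ioo (0 : ℝ) 1, IntegrableOn ψ (Ioo 0 a))
    (h0 : ∀ᵐ t ∂(volume.restrict (Ioo (0 : ℝ) 1)),
      ∫ τ in Ioo 0 t, (t - τ) ^ (N : ℝ) • ψ τ = 0) :
    ∀ᵐ t ∂(volume.restrict (Ioo (0 : ℝ) 1)), ψ t = 0 := by
  induction N with
  | zero =>
    refine ae_eq_zero_of_ae_integral_eq_zero hψ ?_
    simpa using h0
  | succ N ih =>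
    have hN : (0 : ℝ) < N + 1 := by positivity
    -- The integral with kernel $(s-\tau)^N$ is locally integrable in $s$, and its primitive is a
    -- multiple of the integral with kernel $(t-\tau)^{N+1}$, hence zero almost everywhere.
    refine ih (ae_eq_zero_of_ae_integral_eq_zero (fun a ha => ?_) ?_)
    · have := (integrable_rl_kernel hN one_pos (by linarith) (hψ a ha)).integral_prod_left
      refine this.congr ?_
      filter_upwards [ae_restrict_mem measurableSet_Ioo] with s hs
      simpa using integral_rl_kernel_left (b := 1) (a := N + 1) hs
    · filter_upwards [h0, ae_restrict_mem measurableSet_Ioo] with t ht ht'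
      have h := integral_rl_comp hN one_pos (by linarith) (hψ t ht')
      simp only [sub_self, Real.rpow_zero, one_smul, add_sub_cancel_right] at h
      rw [h, show ((N : ℝ) + 1) = ((N + 1 : ℕ) : ℝ) by push_cast; rfl, ht, smul_zero]

/-- A locally integrable function on `(0, 1)` is determined by its Riemann-Liouville integral of
half-integer order. -/
theorem ae_eq_zero_of_ae_rl_eq_zero {α : ℝ} (hα : 0 < α) {N : ℕ} (hN : 2 * α = N + 1) {ψ : ℝ → E}
    (hψ : ∀ a ∈ Ioo (0 : ℝ) 1, IntegrableOn ψ (Ioo 0 a))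
    (h0 : ∀ᵐ t ∂(volume.restrict (Ioo (0 : ℝ) 1)),
      ∫ τ in Ioo 0 t, (t - τ) ^ (α - 1) • ψ τ = 0) :
    ∀ᵐ t ∂(volume.restrict (Ioo (0 : ℝ) 1)), ψ t = 0 := by
  refine ae_eq_zero_of_ae_integral_pow_eq_zero N hψ ?_
  filter_upwards [ae_restrict_mem measurableSet_Ioo] with t ht
  -- A second integration of order $\alpha$ gives the kernel exponent $2\alpha-1=N$.
  have h := integral_rl_comp hα hα (by linarith [(Nat.cast_nonneg N : (0 : ℝ) ≤ N)]) (hψ t ht)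
  rw [show α + α - 1 = N by linarith, integral_eq_zero_of_ae, eq_comm, smul_eq_zero] at h
  · exact h.resolve_left (betaConst_pos hα hα).ne'
  · filter_upwards [ae_restrict_of_ae_restrict_of_subset (Ioo_subset_Ioo_right ht.2.le) h0]
      with s hs
    rw [hs, smul_zero]
    rfl

end RiemannLiouville

/-! ### The profile of the dual transform as a Riemann-Liouville integral -/

section Profile

theorem restrict_Ioo_neg_one_one : (volume.restrict (Ioo (-1 : ℝ) 1)) =
    (volume.restrict (Ioo (0 : ℝ) 1)).map Neg.neg + volume.restrict (Ioo (0 : ℝ) 1) := by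
  have h1 : (volume.restrict (Ioo (0 : ℝ) 1)).map Neg.neg = volume.restrict (Ioo (-1 : ℝ) 0) := by
    have h := (Measure.measurePreserving_neg (volume : Measure ℝ)).restrict_preimage
      (measurableSet_Ioo (a := (-1 : ℝ)) (b := 0))
    have h2 : Neg.neg ⁻¹' Ioo (-1 : ℝ) 0 = Ioo 0 1 := by
      ext s
      simp only [mem_preimage, mem_Ioo]
      constructor <;> rintro ⟨h, h'⟩ <;> constructor <;> linarith
    rw [h2] at h
    exact h.map_eq
  rw [h1, ← Measure.restrict_congr_set (Ioo_ae_eq_Ico (a := (0 : ℝ)) (b := 1)).symm,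
    ← Measure.restrict_union _ measurableSet_Ico, Ioo_union_Ico_eq_Ioo (by norm_num) zero_le_one]
  exact Set.disjoint_left.2 fun s hs hs' => not_lt.2 hs'.1 hs.2

variable {n : ℕ}

theorem map_neg_sliceProb (x : UnitSphere (Euc n)) {t : ℝ} (ht : t ^ 2 ≤ 1) :
    (sliceProb x t).map Neg.neg = sliceProb x (-t) := by
  have hneg := measurePreserving_sphereMap
    (LinearIsometryEquiv.neg ℝ (E := (Submodule.span ℝ {(x : Euc n)})ᗮ))
  have hn : Measurable (Neg.neg : UnitSphere (Euc n) → UnitSphere (Euc n)) :=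
    continuous_neg.measurable
  rw [sliceProb, sliceProb, Measure.map_smul,
    Measure.map_map hn (measurable_sliceMap_right x t), ← hneg.map_eq,
    Measure.map_map (measurable_sliceMap_right x _) hneg.measurable, hneg.map_eq]
  congr 2
  ext1 u
  exact neg_sliceMap x ht u

theorem image_mul_sq {a t : ℝ} (ht : 0 < t) (ha : 0 ≤ a) :
    (fun s => t * s ^ 2) '' Ioo 0 a = Ioo 0 (t * a ^ 2) := by
  ext τ
  constructor
  · rintro ⟨s, hs, rfl⟩
    have := hs.1
    exact ⟨by positivity, mul_lt_mul_of_pos_left (pow_lt_pow_left₀ hs.2 this.le two_ne_zero) ht⟩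
  · intro hτ
    have h1 : 0 < τ / t := div_pos hτ.1 ht
    refine ⟨√(τ / t), ⟨Real.sqrt_pos.2 h1, ?_⟩, ?_⟩
    · rw [Real.sqrt_lt' (lt_of_le_of_ne ha ?_), div_lt_iff₀ ht]
      · linarith [hτ.2]
      · rintro rfl
        have := hτ.1.trans hτ.2
        simp at this
    · simp only [Real.sq_sqrt h1.le]
      field_simp

theorem hasDerivWithinAt_mul_sq (t : ℝ) (S : Set ℝ) (s : ℝ) :
    HasDerivWithinAt (fun s => t * s ^ 2) (2 * t * s) S s := by
  have h := ((hasDerivAt_pow 2 s).const_mul t).hasDerivWithinAt (s := S)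
  refine h.congr_deriv ?_
  push_cast
  ring

theorem injOn_mul_sq {a t : ℝ} (ht : 0 < t) : InjOn (fun s => t * s ^ 2) (Ioo 0 a) := by
  intro s hs r hr h
  simp only [mul_eq_mul_left_iff, ht.ne', or_false] at h
  exact (sq_eq_sq₀ hs.1.le hr.1.le).1 h

theorem setLIntegral_image_sq {a t : ℝ} (ht : 0 < t) (ha : 0 ≤ a) (G : ℝ → ℝ≥0∞) :
    ∫⁻ τ in Ioo 0 (t * a ^ 2), G τ =
      ∫⁻ s in Ioo 0 a, ENNReal.ofReal (2 * t * s) * G (t * s ^ 2) := by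
  rw [← image_mul_sq ht ha, lintegral_image_eq_lintegral_abs_deriv_mul measurableSet_Ioo
    (fun s _ => hasDerivWithinAt_mul_sq t _ s) (injOn_mul_sq ht)]
  refine setLIntegral_congr_fun measurableSet_Ioo fun s hs => ?_
  have := hs.1
  rw [abs_of_nonneg (by positivity)]

theorem setIntegral_image_sq {E : Type*} [NormedAddCommGroup E] [NormedSpace ℝ E] {t : ℝ}
    (ht : 0 < t) (G : ℝ → E) :
    ∫ τ in Ioo 0 t, G τ = ∫ s in Ioo 0 1, (2 * t * s) • G (t * s ^ 2) := by
  rw [show Ioo 0 t = Ioo 0 (t * 1 ^ 2) by simp, ← image_mul_sq ht zero_le_one,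
    integral_image_eq_integral_abs_deriv_smul measurableSet_Ioo
    (fun s _ => hasDerivWithinAt_mul_sq t _ s) (injOn_mul_sq ht)]
  refine setIntegral_congr_fun measurableSet_Ioo fun s hs => ?_
  have := hs.1
  rw [abs_of_nonneg (by positivity)]

/-- The factor $1/\sqrt\tau$ in $\widetilde{f_x}$ cancels the $s$ of the Jacobian of $\tau=ts^2$,
leaving exactly the zonal weight $(1-s^2)^{\alpha-1}$. -/
theorem rl_kernel_mul_sq (α : ℝ) {s t : ℝ} (hs : s ∈ Ioo (0 : ℝ) 1) (ht : 0 < t) :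
    2 * t * s * ((t - t * s ^ 2) ^ (α - 1) * (1 / √(t * s ^ 2))) =
      2 * t ^ (α - 1 / 2) * (1 - s ^ 2) ^ (α - 1) := by
  have h0 := hs.1
  have h1 : 0 < 1 - s ^ 2 := by nlinarith [hs.1, hs.2]
  rw [show t - t * s ^ 2 = t * (1 - s ^ 2) by ring, Real.mul_rpow ht.le h1.le,
    Real.sqrt_mul ht.le, Real.sqrt_sq h0.le, show α - 1 / 2 = (α - 1) + 1 / 2 by ring,
    Real.rpow_add ht, ← Real.sqrt_eq_rpow]
  have h2 : 0 < √t := Real.sqrt_pos.2 ht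
  field_simp
  rw [Real.sq_sqrt ht.le]

variable {𝕜 : Type*} [RCLike 𝕜]

theorem sqrt_mem {t : ℝ} (ht : t ∈ Ioo (0 : ℝ) 1) : √t ∈ Ioo (0 : ℝ) 1 := by
  refine ⟨Real.sqrt_pos.2 ht.1, ?_⟩
  rw [Real.sqrt_lt' one_pos]
  simpa using ht.2

theorem tildeFun_eq (f : UnitSphere (Euc n) → 𝕜) (x : UnitSphere (Euc n)) {t : ℝ}
    (ht : t ∈ Ioo (0 : ℝ) 1) :
    tildeFun f x t = (1 / √t) • ∫ y, f y ∂(sliceProb x √t) := by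
  have h := sqrt_mem ht
  rw [tildeFun, sliceMean_eq_integral f x ⟨by linarith [h.1], h.2⟩]

theorem integral_sliceProb_neg {f : UnitSphere (Euc n) → 𝕜} (hf : StronglyMeasurable f)
    (heven : ∀ y, f (-y) = f y) (x : UnitSphere (Euc n)) {s : ℝ} (hs : s ∈ Ioo (0 : ℝ) 1) :
    ∫ y, f y ∂(sliceProb x (-s)) = ∫ y, f y ∂(sliceProb x s) := by
  rw [← map_neg_sliceProb x (by nlinarith [hs.1, hs.2]),
    integral_map continuous_neg.measurable.aemeasurable hf.aestronglyMeasurable]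
  simp_rw [heven]

/-- Symmetrize a measurable representative. Evenness at every point makes the slice means at heights
$s$ and $-s$ agree for every $s$. -/
theorem exists_even_representative {f : UnitSphere (Euc n) → 𝕜}
    (hf : Integrable f (sphereMeasure (Euc n)))
    (heven : ∀ᵐ x ∂(sphereMeasure (Euc n)), f (-x) = f x) :
    ∃ g : UnitSphere (Euc n) → 𝕜, StronglyMeasurable g ∧ (∀ y, g (-y) = g y) ∧
      f =ᵐ[sphereMeasure (Euc n)] g := by
  obtain ⟨f₀, hf₀, hff₀⟩ := hf.1
  have hneg : MeasurePreserving (Neg.neg : UnitSphere (Euc n) → UnitSphere (Euc n))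
      (sphereMeasure (Euc n)) (sphereMeasure (Euc n)) :=
    measurePreserving_sphereMap (LinearIsometryEquiv.neg ℝ (E := Euc n))
  refine ⟨fun y => (1 / 2 : ℝ) • (f₀ y + f₀ (-y)), ?_, fun y => ?_, ?_⟩
  · exact (hf₀.add (hf₀.comp_measurable hneg.measurable)).const_smul _
  · simp only [neg_neg, add_comm]
  · filter_upwards [hff₀, hneg.quasiMeasurePreserving.ae hff₀, heven] with y h1 h2 h3
    rw [← h1, ← h2, h3, ← two_smul ℝ (f y), smul_smul]
    norm_num

theorem rlIntegral_tildeFun (f : UnitSphere (Euc n) → 𝕜) (x : UnitSphere (Euc n)) (α : ℝ) {t : ℝ}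
    (ht : t ∈ Ioo (0 : ℝ) 1) : rlIntegral α (tildeFun f x) t =
      (1 / Real.Gamma α * (2 * t ^ (α - 1 / 2))) •
        ∫ s in Ioo (0 : ℝ) 1, (1 - s ^ 2) ^ (α - 1) • ∫ y, f y ∂(sliceProb x (√t * s)) := by
  rw [rlIntegral, intervalIntegral.integral_of_le ht.1.le, integral_Ioc_eq_integral_Ioo,
    setIntegral_image_sq ht.1, mul_smul, ← integral_smul (2 * t ^ (α - 1 / 2))]
  congr 1
  refine integral_congr_ae ?_
  filter_upwards [ae_restrict_mem measurableSet_Ioo] with s hs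
  have h1 : t * s ^ 2 ∈ Ioo (0 : ℝ) 1 := by
    have h0 := hs.1
    have h0' := ht.1
    refine ⟨by positivity, ?_⟩
    nlinarith [mul_pos h0 h0, hs.2, ht.2]
  rw [tildeFun_eq f x h1, smul_smul, smul_smul, mul_assoc (2 * t * s),
    rl_kernel_mul_sq α hs ht.1, smul_smul,
    Real.sqrt_mul ht.1.le, Real.sqrt_sq hs.1.le]

variable [hn : Fact (3 ≤ n)]

/-- With $\tau=s^2$ this is twice the integral of the slice means over $(0,\sqrt a)$, where the
slicing weight $(1-s^2)^{(n-3)/2}$ is at least $(1-a)^{(n-3)/2}>0$. For $n>3$ the weight degenerates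
at $s=1$, hence $a<1$. -/
theorem lintegral_sliceProb_sqrt_ne_top {F : UnitSphere (Euc n) → ℝ≥0∞} (hF : Measurable F)
    (hfin : ∫⁻ y, F y ∂(sphereMeasure (Euc n)) ≠ ⊤) (x : UnitSphere (Euc n)) {a : ℝ}
    (ha : a ∈ Ioo (0 : ℝ) 1) :
    ∫⁻ τ in Ioo 0 a, ENNReal.ofReal (1 / √τ) * ∫⁻ y, F y ∂(sliceProb x √τ) ≠ ⊤ := by
  set P := fun s => ∫⁻ y, F y ∂(sliceProb x s) with hP
  set e : ℝ := (((n - 2 : ℕ) : ℝ) - 1) / 2 with he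
  have he0 : 0 ≤ e := by
    have : 1 ≤ n - 2 := by have := hn.out; omega
    have : (1 : ℝ) ≤ ((n - 2 : ℕ) : ℝ) := by exact_mod_cast this
    rw [he]
    linarith
  have hPm : Measurable P := measurable_lintegral_sliceProb x hF
  have hsa : √a ^ 2 = a := Real.sq_sqrt ha.1.le
  have hsa1 : √a < 1 := by
    rw [Real.sqrt_lt' one_pos]
    simpa using ha.2
  have h1a : 0 < (1 - a) ^ e := Real.rpow_pos_of_pos (sub_pos.2 ha.2) _
  rw [lintegral_sphere_eq_slices x hF] at hfin
  have hfin' : ∫⁻ s in Ioo (-1 : ℝ) 1, ENNReal.ofReal ((1 - s ^ 2) ^ e) * P s ≠ ⊤ := by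
    intro h
    rw [h, ENNReal.mul_top (by simpa using sphereArea_pos (n - 2))] at hfin
    exact hfin rfl
  have h2 : ∫⁻ s in Ioo 0 (√a), P s ≠ ⊤ := by
    have hle : ENNReal.ofReal ((1 - a) ^ e) * ∫⁻ s in Ioo 0 (√a), P s ≤
        ∫⁻ s in Ioo (-1 : ℝ) 1, ENNReal.ofReal ((1 - s ^ 2) ^ e) * P s := by
      rw [← lintegral_const_mul _ hPm]
      refine (setLIntegral_mono (by fun_prop) fun s hs => ?_).trans
        (lintegral_mono_set (Ioo_subset_Ioo (by norm_num) hsa1.le))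
      gcongr
      · linarith [ha.2]
      · rw [← hsa]
        have := hs.1
        gcongr
        exact hs.2.le
    intro h
    rw [h, ENNReal.mul_top (by simpa using h1a)] at hle
    exact hfin' (top_le_iff.1 hle)
  have h3 := setLIntegral_image_sq one_pos (Real.sqrt_nonneg a)
    fun τ => ENNReal.ofReal (1 / √τ) * P √τ
  rw [hsa, one_mul] at h3
  rw [h3]
  have h4 : ∀ s ∈ Ioo 0 (√a), ENNReal.ofReal (2 * 1 * s) *
      (ENNReal.ofReal (1 / √(1 * s ^ 2)) * P √(1 * s ^ 2)) = ENNReal.ofReal 2 * P s := by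
    intro s hs
    rw [one_mul, Real.sqrt_sq hs.1.le, ← mul_assoc, ← ENNReal.ofReal_mul (by linarith [hs.1])]
    congr 2
    have := hs.1.ne'
    field_simp
  rw [setLIntegral_congr_fun measurableSet_Ioo h4, lintegral_const_mul _ hPm]
  exact ENNReal.mul_ne_top ENNReal.ofReal_ne_top h2

theorem half_sub_one_eq (n : ℕ) [hn : Fact (3 ≤ n)] :
    (((n - 3 : ℕ) : ℝ) - 1) / 2 = ((n : ℝ) - 2) / 2 - 1 := by
  rw [Nat.cast_sub hn.out]
  push_cast
  ring

theorem order_pos (n : ℕ) [hn : Fact (3 ≤ n)] : 0 < ((n : ℝ) - 2) / 2 := by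
  have : (3 : ℝ) ≤ n := by exact_mod_cast hn.out
  linarith

theorem sqrt_mul_sq_mem {s t : ℝ} (hs : s ∈ Ioo (0 : ℝ) 1) (ht : t ∈ Ioo (0 : ℝ) 1) :
    √t * s ∈ Ioo (0 : ℝ) 1 := by
  have h0 : 0 < √t := Real.sqrt_pos.2 ht.1
  have h1 : √t < 1 := by
    rw [Real.sqrt_lt' one_pos]
    simpa using ht.2
  exact ⟨mul_pos h0 hs.1, by nlinarith [hs.1, hs.2]⟩

/-- For almost every `t`, the integral defining the composition of the two transforms converges
absolutely. -/
theorem ae_lintegral_dual_ne_top {F : UnitSphere (Euc n) → ℝ≥0∞} (hF : Measurable F)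
    (heven : ∀ y, F (-y) = F y)
    (hfin : ∫⁻ y, F y ∂(sphereMeasure (Euc n)) ≠ ⊤) (x : UnitSphere (Euc n)) :
    ∀ᵐ t ∂(volume.restrict (Ioo (0 : ℝ) 1)), ∫⁻ s in Ioo (-1 : ℝ) 1,
        ENNReal.ofReal ((1 - s ^ 2) ^ ((((n - 3 : ℕ) : ℝ) - 1) / 2)) *
          ∫⁻ y, F y ∂(sliceProb x (√t * s)) ≠ ⊤ := by
  have hPm := measurable_lintegral_sliceProb x hF
  have hneg : ∀ s ∈ Ioo (0 : ℝ) 1, ∫⁻ y, F y ∂(sliceProb x (-s)) =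
      ∫⁻ y, F y ∂(sliceProb x s) := by
    intro s hs
    rw [← map_neg_sliceProb x (by nlinarith [hs.1, hs.2]),
      lintegral_map hF continuous_neg.measurable]
    simp_rw [heven]
  have hloc := fun a ha => lintegral_sliceProb_sqrt_ne_top hF hfin x (a := a) ha
  obtain ⟨P, hP⟩ : ∃ P : ℝ → ℝ≥0∞, ∀ s, ∫⁻ y, F y ∂(sliceProb x s) = P s := ⟨_, fun _ => rfl⟩
  simp_rw [hP] at hPm hneg hloc ⊢
  filter_upwards [ae_lintegral_rl_lt_top (order_pos n) (by fun_prop)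
    hloc,
    ae_restrict_mem measurableSet_Ioo] with t ht ht'
  rw [half_sub_one_eq]
  set α := ((n : ℝ) - 2) / 2 with hα
  have h1 := setLIntegral_image_sq ht'.1 zero_le_one fun τ =>
    ENNReal.ofReal ((t - τ) ^ (α - 1)) *
      (ENNReal.ofReal (1 / √τ) * P √τ)
  rw [one_pow, mul_one] at h1
  have h2 : ∀ s ∈ Ioo (0 : ℝ) 1, ENNReal.ofReal (2 * t * s) *
      (ENNReal.ofReal ((t - t * s ^ 2) ^ (α - 1)) *
        (ENNReal.ofReal (1 / √(t * s ^ 2)) * P √(t * s ^ 2))) =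
      ENNReal.ofReal (2 * t ^ (α - 1 / 2)) * (ENNReal.ofReal ((1 - s ^ 2) ^ (α - 1)) *
        P (√t * s)) := by
    intro s hs
    have h3 : 0 < 1 - s ^ 2 := by nlinarith [hs.1, hs.2]
    have h4 : 0 ≤ t - t * s ^ 2 := by nlinarith [mul_pos ht'.1 h3]
    have h5 := ht'.1
    have h6 := hs.1
    rw [← mul_assoc (ENNReal.ofReal ((t - t * s ^ 2) ^ (α - 1))), ← mul_assoc, ← mul_assoc,
      ← ENNReal.ofReal_mul (by positivity), ← ENNReal.ofReal_mul (by positivity),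
      mul_assoc (2 * t * s), rl_kernel_mul_sq α hs ht'.1, ENNReal.ofReal_mul (by positivity),
      Real.sqrt_mul ht'.1.le, Real.sqrt_sq h6.le, mul_assoc]
  rw [h1, setLIntegral_congr_fun measurableSet_Ioo h2, lintegral_const_mul _ (by fun_prop)] at ht
  have h7 : ∫⁻ s in Ioo (0 : ℝ) 1, ENNReal.ofReal ((1 - s ^ 2) ^ (α - 1)) *
      P (√t * s) ≠ ⊤ := by
    intro h
    rw [h, ENNReal.mul_top] at ht
    · exact ht.ne rfl
    · have := Real.rpow_pos_of_pos ht'.1 (α - 1 / 2)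
      simpa using this
  rw [restrict_Ioo_neg_one_one, lintegral_add_measure,
    lintegral_map (by fun_prop) measurable_neg]
  refine ENNReal.add_ne_top.2 ⟨?_, h7⟩
  rw [setLIntegral_congr_fun measurableSet_Ioo fun s hs => ?_]
  · exact h7
  · rw [neg_sq, mul_neg, hneg _ (sqrt_mul_sq_mem hs ht')]

theorem integrableOn_tildeFun {f : UnitSphere (Euc n) → 𝕜} (hf : StronglyMeasurable f)
    (hfi : Integrable f (sphereMeasure (Euc n))) (x : UnitSphere (Euc n)) {a : ℝ}
    (ha : a ∈ Ioo (0 : ℝ) 1) : IntegrableOn (tildeFun f x) (Ioo 0 a) := by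
  have hm : StronglyMeasurable fun t : ℝ => (1 / √t) • ∫ y, f y ∂(sliceProb x √t) :=
    (by fun_prop : Measurable fun t : ℝ => 1 / √t).stronglyMeasurable.smul
      ((stronglyMeasurable_integral_sliceProb x hf).comp_measurable (by fun_prop))
  have hi : IntegrableOn (fun t : ℝ => (1 / √t) • ∫ y, f y ∂(sliceProb x √t)) (Ioo 0 a) := by
    refine ⟨hm.aestronglyMeasurable, ?_⟩
    rw [hasFiniteIntegral_iff_enorm]
    have hfin := hfi.2
    rw [hasFiniteIntegral_iff_enorm] at hfin
    refine lt_of_le_of_lt (lintegral_mono fun t => ?_)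
      (lintegral_sliceProb_sqrt_ne_top hf.enorm hfin.ne x ha).lt_top
    rw [enorm_smul, Real.enorm_of_nonneg (by positivity)]
    gcongr
    exact enorm_integral_le_lintegral_enorm _
  refine hi.congr ?_
  filter_upwards [ae_restrict_mem measurableSet_Ioo] with t ht
  rw [tildeFun_eq f x ⟨ht.1, ht.2.trans ha.2⟩]

theorem sphereArea_eq (n : ℕ) [hn : Fact (3 ≤ n)] : sphereArea (n - 3) =
    2 * Real.pi ^ (((n : ℝ) - 2) / 2) / Real.Gamma (((n : ℝ) - 2) / 2) := by
  have : (((n - 3 : ℕ) : ℝ) + 1) / 2 = ((n : ℝ) - 2) / 2 := by linarith [half_sub_one_eq n]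
  rw [sphereArea, this]

/-- The heart of the inversion. Both sides are multiples of $\int_0^1(1-s^2)^{\alpha-1}(M^{\sqrt t
s}f)(x)\,ds$. The constant $2\pi^\alpha$ is $\Gamma(\alpha)\sigma_{n-3}$: the $2$ from folding
matches the $2$ of the Jacobian, and $t^{(n-3)/2}=t^{\alpha-1/2}$. -/
theorem dualFunkProfile_ae_eq {f : UnitSphere (Euc n) → 𝕜} (hf : StronglyMeasurable f)
    (hfi : Integrable f (sphereMeasure (Euc n))) (heven : ∀ y, f (-y) = f y)
    (k : {k : Fin n // k ≠ lastIdx n}) (x : UnitSphere (Euc n)) :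
    ∀ᵐ t ∂(volume.restrict (Ioo (0 : ℝ) 1)), dualFunkProfile k f x t =
      (2 * Real.pi ^ (((n : ℝ) - 2) / 2)) • rlIntegral (((n : ℝ) - 2) / 2) (tildeFun f x) t := by
  have hfin := hfi.2
  rw [hasFiniteIntegral_iff_enorm] at hfin
  filter_upwards [ae_lintegral_dual_ne_top hf.enorm (fun y => by rw [heven]) hfin.ne x,
    ae_restrict_mem measurableSet_Ioo] with t ht ht'
  have hst := sqrt_mem ht'
  have hcos : Real.cos (Real.arccos √t) = √t :=
    Real.cos_arccos (by linarith [hst.1]) hst.2.le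
  rw [dualFunkProfile, dualFunk_funk_eq_integral hf k _ x (by rwa [hcos]), hcos,
    rlIntegral_tildeFun f x _ ht', sphereArea_eq]
  rw [half_sub_one_eq] at ht ⊢
  set α := ((n : ℝ) - 2) / 2 with hα
  set G : ℝ → 𝕜 := fun s => (1 - s ^ 2) ^ (α - 1) • ∫ y, f y ∂(sliceProb x (√t * s)) with hG
  have hGm : StronglyMeasurable G :=
    (by fun_prop : Measurable fun s : ℝ => (1 - s ^ 2) ^ (α - 1)).stronglyMeasurable.smul
      ((stronglyMeasurable_integral_sliceProb x hf).comp_measurable (by fun_prop))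
  have hGi : IntegrableOn G (Ioo (-1) 1) := by
    refine ⟨hGm.aestronglyMeasurable, ?_⟩
    rw [hasFiniteIntegral_iff_enorm]
    refine lt_of_le_of_lt (setLIntegral_mono' measurableSet_Ioo fun s hs => ?_) ht.lt_top
    have h1 : 0 ≤ 1 - s ^ 2 := by nlinarith [hs.1, hs.2]
    rw [hG, enorm_smul, Real.enorm_of_nonneg (Real.rpow_nonneg h1 _)]
    gcongr
    exact enorm_integral_le_lintegral_enorm _
  have hGi0 : IntegrableOn G (Ioo 0 1) := hGi.mono_set (Ioo_subset_Ioo_left (by norm_num))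
  have hGneg : ∀ s ∈ Ioo (0 : ℝ) 1, G (-s) = G s := by
    intro s hs
    simp only [hG]
    rw [neg_sq, mul_neg, integral_sliceProb_neg hf heven x (sqrt_mul_sq_mem hs ht')]
  have hsplit : ∫ s in Ioo (-1 : ℝ) 1, G s = (2 : ℝ) • ∫ s in Ioo (0 : ℝ) 1, G s := by
    have hn : Integrable G ((volume.restrict (Ioo (0 : ℝ) 1)).map Neg.neg) := by
      rw [integrable_map_measure hGm.aestronglyMeasurable measurable_neg.aemeasurable]
      refine hGi0.congr ?_
      filter_upwards [ae_restrict_mem measurableSet_Ioo] with s hs using (hGneg s hs).symm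
    rw [restrict_Ioo_neg_one_one, integral_add_measure hn hGi0,
      integral_map measurable_neg.aemeasurable hGm.aestronglyMeasurable,
      setIntegral_congr_fun measurableSet_Ioo hGneg, two_smul]
  rw [hsplit, smul_smul, smul_smul, smul_smul, show ((n : ℝ) - 3) / 2 = α - 1 / 2 by
    rw [hα]; ring]
  congr 1
  ring

/-! ### Null sets and the two transforms -/

/-- Equality at every $t\in(0,1)$, since there $\cos\theta=\sqrt t$ lies in $(0,1)$ and `ae_dual`
applies. -/
theorem dualFunkProfile_congr {f g : UnitSphere (Euc n) → 𝕜}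
    (h : f =ᵐ[sphereMeasure (Euc n)] g) (k : {k : Fin n // k ≠ lastIdx n})
    (x : UnitSphere (Euc n)) {t : ℝ} (ht : t ∈ Ioo (0 : ℝ) 1) :
    dualFunkProfile k f x t = dualFunkProfile k g x t := by
  have hst := sqrt_mem ht
  have hcos : Real.cos (Real.arccos √t) ∈ Ioo (0 : ℝ) 1 := by
    rwa [Real.cos_arccos (by linarith [hst.1]) hst.2.le]
  rw [dualFunkProfile, dualFunkProfile, dualFunk_funk, dualFunk_funk]
  congr 1
  refine integral_congr_ae ?_
  filter_upwards [ae_dual k hcos x h] with ρ hρ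
  exact integral_congr_ae hρ

/-- The exceptional set of $t$ lies in the image under squaring of the exceptional set of $s$, and a
differentiable map sends null sets to null sets. -/
theorem ae_sqrt {p : ℝ → Prop} (hp : ∀ᵐ s ∂(volume.restrict (Ioo (-1 : ℝ) 1)), p s) :
    ∀ᵐ t ∂(volume.restrict (Ioo (0 : ℝ) 1)), p √t := by
  rw [ae_restrict_iff' measurableSet_Ioo, ae_iff] at hp ⊢
  have h := addHaar_image_eq_zero_of_differentiableOn_of_addHaar_eq_zero volume
    (f := fun s : ℝ => s ^ 2) (by fun_prop) hp
  refine measure_mono_null (fun t ht => ?_) h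
  simp only [mem_ofPred_eq, Classical.not_imp] at ht
  have hs := sqrt_mem ht.1
  refine ⟨√t, ?_, Real.sq_sqrt ht.1.1.le⟩
  simp only [mem_ofPred_eq, Classical.not_imp]
  exact ⟨⟨by linarith [hs.1], hs.2⟩, ht.2⟩

theorem tildeFun_congr {f g : UnitSphere (Euc n) → 𝕜}
    (h : f =ᵐ[sphereMeasure (Euc n)] g) (x : UnitSphere (Euc n)) :
    tildeFun f x =ᵐ[volume.restrict (Ioo (0 : ℝ) 1)] tildeFun g x := by
  filter_upwards [ae_sqrt (ae_ae_sliceProb x h), ae_restrict_mem measurableSet_Ioo] with t ht ht'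
  rw [tildeFun_eq f x ht', tildeFun_eq g x ht', integral_congr_ae ht]

theorem IsRLPreimage.ae_eq {α : ℝ} (hα : 0 < α) {N : ℕ} (hN : 2 * α = N + 1) {g ψ φ : ℝ → 𝕜}
    (hψ : IsRLPreimage α 1 g ψ) (hφ : IsRLPreimage α 1 g φ) :
    ψ =ᵐ[volume.restrict (Ioo (0 : ℝ) 1)] φ := by
  have h := ae_eq_zero_of_ae_rl_eq_zero hα hN (ψ := fun t => ψ t - φ t)
    (fun a ha => (hψ.1 a ha).sub (hφ.1 a ha)) ?_
  · filter_upwards [h] with t ht using sub_eq_zero.1 ht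
  -- Convergence of both integrals is needed before the integral of the difference can be split.
  · filter_upwards [hψ.2, hφ.2, ae_integrableOn_rl hα hψ.1, ae_integrableOn_rl hα hφ.1,
      ae_restrict_mem measurableSet_Ioo] with t h1 h2 h3 h4 ht
    have h5 : rlIntegral α ψ t = rlIntegral α φ t := h1.trans h2.symm
    have hΓ : (1 / Real.Gamma α) ≠ 0 := (one_div_pos.2 (Real.Gamma_pos_of_pos hα)).ne'
    rw [rlIntegral, rlIntegral, intervalIntegral.integral_of_le ht.1.le,
      intervalIntegral.integral_of_le ht.1.le, integral_Ioc_eq_integral_Ioo,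
      integral_Ioc_eq_integral_Ioo] at h5
    have h6 := smul_right_injective 𝕜 hΓ h5
    simp_rw [smul_sub]
    rw [integral_sub h3 h4, h6, sub_self]

theorem rlIntegral_const_smul (α c : ℝ) (ψ : ℝ → 𝕜) (t : ℝ) :
    rlIntegral α (fun τ => c • ψ τ) t = c • rlIntegral α ψ t := by
  simp_rw [rlIntegral, smul_comm _ c]
  rw [intervalIntegral.integral_smul, smul_comm]

/-- The inversion formula. -/
theorem isRLPreimage_dualFunkProfile {f : UnitSphere (Euc n) → 𝕜}
    (hf : Integrable f (sphereMeasure (Euc n)))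
    (heven : ∀ᵐ x ∂(sphereMeasure (Euc n)), f (-x) = f x)
    (k : {k : Fin n // k ≠ lastIdx n}) (x : UnitSphere (Euc n)) :
    ∃ ψ, IsRLPreimage (((n : ℝ) - 2) / 2) 1 (dualFunkProfile k f x) ψ ∧
      ∀ᵐ t ∂(volume.restrict (Ioo (0 : ℝ) 1)),
        tildeFun f x t = (2 * Real.pi ^ (((n : ℝ) - 2) / 2))⁻¹ • ψ t := by
  obtain ⟨g, hg, hge, hfg⟩ := exists_even_representative hf heven
  have hgi : Integrable g (sphereMeasure (Euc n)) := hf.congr hfg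
  have hc : (2 * Real.pi ^ (((n : ℝ) - 2) / 2)) ≠ 0 := by positivity
  refine ⟨fun t => (2 * Real.pi ^ (((n : ℝ) - 2) / 2)) • tildeFun g x t, ⟨fun a ha =>
    Integrable.smul (2 * Real.pi ^ (((n : ℝ) - 2) / 2)) (integrableOn_tildeFun hg hgi x ha),
      ?_⟩, ?_⟩
  · filter_upwards [dualFunkProfile_ae_eq hg hgi hge k x, ae_restrict_mem measurableSet_Ioo]
      with t ht ht'
    rw [rlIntegral_const_smul, dualFunkProfile_congr hfg k x ht', ht]
  · filter_upwards [tildeFun_congr hfg x] with t ht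
    rw [ht, smul_smul, inv_mul_cancel₀ hc, one_smul]

/-- `rlDeriv` is an arbitrary choice of preimage. By uniqueness it agrees almost everywhere with the
explicit one. -/
theorem tildeFun_ae_eq_rlDeriv {f : UnitSphere (Euc n) → 𝕜}
    (hf : Integrable f (sphereMeasure (Euc n)))
    (heven : ∀ᵐ x ∂(sphereMeasure (Euc n)), f (-x) = f x)
    (k : {k : Fin n // k ≠ lastIdx n}) (x : UnitSphere (Euc n)) :
    ∀ᵐ t ∂(volume.restrict (Ioo (0 : ℝ) 1)), tildeFun f x t =
      (2 * Real.pi ^ (((n : ℝ) - 2) / 2))⁻¹ •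
        rlDeriv (((n : ℝ) - 2) / 2) 1 (dualFunkProfile k f x) t := by
  obtain ⟨ψ, hψ, hψf⟩ := isRLPreimage_dualFunkProfile hf heven k x
  have hex : ∃ ψ, IsRLPreimage (((n : ℝ) - 2) / 2) 1 (dualFunkProfile k f x) ψ := ⟨ψ, hψ⟩
  have hN : 2 * (((n : ℝ) - 2) / 2) = ((n - 3 : ℕ) : ℝ) + 1 := by
    linarith [half_sub_one_eq n]
  filter_upwards [hψf, hψ.ae_eq (order_pos n) hN hex.choose_spec] with t h1 h2
  rw [h1, h2, rlDeriv, dif_pos hex]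

end Profile

/-! ### Convergence of the slice averages -/

section Limit

variable {n : ℕ} {𝕜 : Type*} [RCLike 𝕜]

theorem ae_dist_sliceProb (x : UnitSphere (Euc n)) {t : ℝ} (ht : t ^ 2 ≤ 1) :
    ∀ᵐ y ∂(sliceProb x t), dist y x ^ 2 = 2 - 2 * t := by
  refine Measure.ae_smul_measure ?_ _
  rw [ae_map_iff (measurable_sliceMap_right x t).aemeasurable
    (measurableSet_eq_fun (by fun_prop) measurable_const)]
  exact Eventually.of_forall fun u => dist_sliceMap_sq x ht u

/-- All points of the slice lie at the same distance $\sqrt{2-2\sqrt t}$ from $x$, whatever $x$ is,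
and $f$ is uniformly continuous on the compact sphere. -/
theorem eventually_ae_dist_lt {f : UnitSphere (Euc n) → 𝕜} (hf : Continuous f) {ε : ℝ}
    (hε : 0 < ε) : ∀ᶠ t in 𝓝[<] (1 : ℝ), ∀ x, ∀ᵐ y ∂(sliceProb x √t), dist (f y) (f x) < ε := by
  obtain ⟨δ, hδ, hδf⟩ := Metric.uniformContinuous_iff.1
    (CompactSpace.uniformContinuous_of_continuous hf) ε hε
  have hlim : Tendsto (fun t : ℝ => 2 - 2 * √t) (𝓝[<] 1) (𝓝 (2 - 2 * √1)) :=
    (Continuous.tendsto (by fun_prop) 1).mono_left nhdsWithin_le_nhds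
  have hev : ∀ᶠ t in 𝓝[<] (1 : ℝ), 2 - 2 * √t < δ ^ 2 :=
    hlim.eventually_lt_const (by rw [Real.sqrt_one]; ring_nf; positivity)
  filter_upwards [hev, Ioo_mem_nhdsLT (zero_lt_one' ℝ)] with t ht ht' x
  have hs := sqrt_mem ht'
  filter_upwards [ae_dist_sliceProb x (t := √t) (by nlinarith [hs.1, hs.2])] with y hy
  exact hδf (lt_of_pow_lt_pow_left₀ 2 hδ.le (hy ▸ ht))

theorem sqrt_smul_tildeFun (f : UnitSphere (Euc n) → 𝕜) (x : UnitSphere (Euc n)) {t : ℝ}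
    (ht : t ∈ Ioo (0 : ℝ) 1) : √t • tildeFun f x t = ∫ y, f y ∂(sliceProb x √t) := by
  rw [tildeFun_eq f x ht, smul_smul, mul_one_div_cancel (sqrt_mem ht).1.ne', one_smul]

variable [hn : Fact (3 ≤ n)]

theorem tendstoUniformly_tildeFun {f : UnitSphere (Euc n) → 𝕜} (hf : Continuous f) :
    TendstoUniformly (fun (t : ℝ) x => √t • tildeFun f x t) f (𝓝[<] 1) := by
  rw [Metric.tendstoUniformly_iff]
  intro ε hε
  filter_upwards [eventually_ae_dist_lt hf (half_pos hε), Ioo_mem_nhdsLT (zero_lt_one' ℝ)]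
    with t ht ht' x
  rw [sqrt_smul_tildeFun f x ht', dist_comm, dist_eq_norm]
  obtain ⟨C, hC⟩ := isCompact_univ.exists_bound_of_continuousOn hf.continuousOn
  have hfi : Integrable f (sliceProb x √t) :=
    Integrable.of_bound hf.aestronglyMeasurable C (Eventually.of_forall fun y => hC y (mem_univ y))
  have h1 : ∫ y, f y ∂(sliceProb x √t) - f x = ∫ y, (f y - f x) ∂(sliceProb x √t) := by
    rw [integral_sub hfi (integrable_const _)]
    simp
  rw [h1]
  refine lt_of_le_of_lt (norm_integral_le_of_norm_le_const (C := ε / 2) ?_) ?_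
  · filter_upwards [ht x] with y hy
    rw [← dist_eq_norm]
    exact hy.le
  · simp [half_lt_self hε]

/-- The counterpart of `ae_ae_sliceProb` with the roles exchanged: here $t$ is fixed and the
exceptional set is one of centers $x$. -/
theorem ae_ae_sliceProb_left {t : ℝ} (ht : t ^ 2 ≤ 1) {p : UnitSphere (Euc n) → Prop}
    (hp : ∀ᵐ y ∂(sphereMeasure (Euc n)), p y) :
    ∀ᵐ x ∂(sphereMeasure (Euc n)), ∀ᵐ y ∂(sliceProb x t), p y := by
  obtain ⟨N, hpN, hN, hN0⟩ := exists_measurable_superset_of_null (ae_iff.1 hp)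
  have h := lintegral_lintegral_sliceProb ht (F := N.indicator 1) (measurable_one.indicator hN)
  rw [lintegral_indicator_one hN, hN0, lintegral_eq_zero_iff
    (measurable_lintegral_sliceProb_left ht (measurable_one.indicator hN))] at h
  filter_upwards [h] with x hx
  rw [Pi.zero_apply, lintegral_indicator_one hN] at hx
  exact measure_mono_null hpN hx

theorem integrable_integral_sliceProb {t : ℝ} (ht : t ^ 2 ≤ 1) {f : UnitSphere (Euc n) → 𝕜}
    (hf : Integrable f (sphereMeasure (Euc n))) :
    Integrable (fun x => ∫ y, f y ∂(sliceProb x t)) (sphereMeasure (Euc n)) := by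
  obtain ⟨g, hg, hfg⟩ := hf.1
  have hgi := (hf.congr hfg).2
  rw [hasFiniteIntegral_iff_enorm] at hgi
  have hi : Integrable (fun x => ∫ y, g y ∂(sliceProb x t)) (sphereMeasure (Euc n)) := by
    refine ⟨(stronglyMeasurable_integral_sliceProb_left ht hg).aestronglyMeasurable, ?_⟩
    rw [hasFiniteIntegral_iff_enorm]
    refine lt_of_le_of_lt (lintegral_mono fun x => enorm_integral_le_lintegral_enorm _) ?_
    rwa [lintegral_lintegral_sliceProb ht hg.enorm]
  refine hi.congr ?_
  filter_upwards [ae_ae_sliceProb_left ht hfg] with x hx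
  exact (integral_congr_ae hx).symm

/-- Split $f(y)-f(x)$ through $g(y)$ and $g(x)$. The first term returns $\|f-g\|_1$ because slice
means preserve the total integral. -/
theorem lintegral_enorm_sliceProb_sub_le {t : ℝ} (ht : t ^ 2 ≤ 1) {f g : UnitSphere (Euc n) → 𝕜}
    (hf : StronglyMeasurable f) (hfi : Integrable f (sphereMeasure (Euc n))) (hg : Continuous g)
    {η : ℝ≥0} (hη : ∀ x, ∀ᵐ y ∂(sliceProb x t), dist (g y) (g x) < η) :
    ∫⁻ x, ‖∫ y, f y ∂(sliceProb x t) - f x‖ₑ ∂(sphereMeasure (Euc n)) ≤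
      ∫⁻ x, ‖f x - g x‖ₑ ∂(sphereMeasure (Euc n)) + η * sphereMeasure (Euc n) univ +
        ∫⁻ x, ‖f x - g x‖ₑ ∂(sphereMeasure (Euc n)) := by
  have hfg : Measurable fun x => ‖f x - g x‖ₑ := (hf.sub hg.stronglyMeasurable).enorm
  have hfin := hfi.2
  rw [hasFiniteIntegral_iff_enorm, ← lintegral_lintegral_sliceProb ht hf.enorm] at hfin
  have hae := ae_lt_top (measurable_lintegral_sliceProb_left ht hf.enorm) hfin.ne
  have hle : ∀ᵐ x ∂(sphereMeasure (Euc n)), ‖∫ y, f y ∂(sliceProb x t) - f x‖ₑ ≤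
      ∫⁻ y, ‖f y - g y‖ₑ ∂(sliceProb x t) + η + ‖f x - g x‖ₑ := by
    filter_upwards [hae] with x hx
    have hfx : Integrable f (sliceProb x t) :=
      ⟨hf.aestronglyMeasurable, hasFiniteIntegral_iff_enorm.2 hx⟩
    have h1 : ∫ y, f y ∂(sliceProb x t) - f x = ∫ y, (f y - f x) ∂(sliceProb x t) := by
      rw [integral_sub hfx (integrable_const _)]
      simp
    rw [h1]
    refine (enorm_integral_le_lintegral_enorm _).trans ?_
    have h2 : ∫⁻ y, (‖f y - g y‖ₑ + (η + ‖f x - g x‖ₑ)) ∂(sliceProb x t) =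
        ∫⁻ y, ‖f y - g y‖ₑ ∂(sliceProb x t) + η + ‖f x - g x‖ₑ := by
      rw [lintegral_add_left hfg]
      simp [add_assoc]
    rw [← h2]
    refine lintegral_mono_ae ?_
    filter_upwards [hη x] with y hy
    have h3 : ‖g y - g x‖ₑ ≤ η := by
      rw [enorm_le_coe, ← NNReal.coe_le_coe, coe_nnnorm, ← dist_eq_norm]
      exact hy.le
    calc ‖f y - f x‖ₑ = ‖(f y - g y) + ((g y - g x) + (g x - f x))‖ₑ := by congr 1; ring
      _ ≤ ‖f y - g y‖ₑ + (‖g y - g x‖ₑ + ‖g x - f x‖ₑ) :=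
        (enorm_add_le _ _).trans (by gcongr; exact enorm_add_le _ _)
      _ ≤ ‖f y - g y‖ₑ + (η + ‖f x - g x‖ₑ) := by
        rw [enorm_sub_rev (g x)]
        gcongr
  refine (lintegral_mono_ae hle).trans_eq ?_
  rw [lintegral_add_right _ hfg, lintegral_add_right _ measurable_const, lintegral_const,
    lintegral_lintegral_sliceProb ht hfg]

theorem tendsto_lintegral_sliceProb_sub {f : UnitSphere (Euc n) → 𝕜}
    (hf : StronglyMeasurable f) (hfi : Integrable f (sphereMeasure (Euc n))) :
    Tendsto (fun t : ℝ => ∫⁻ x, ‖∫ y, f y ∂(sliceProb x √t) - f x‖ₑ ∂(sphereMeasure (Euc n)))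
      (𝓝[<] 1) (𝓝 0) := by
  rw [ENNReal.tendsto_nhds_zero]
  intro ε hε
  have hε3 : ε / 3 ≠ 0 := (ENNReal.div_pos hε.ne' (by norm_num)).ne'
  -- Each of the three error terms gets $\varepsilon/3$: two from the $L^1$ approximation, one from
  -- the oscillation $\eta$ times the area.
  obtain ⟨g, hg, -⟩ := hfi.exists_boundedContinuous_lintegral_sub_le hε3
  obtain ⟨η, hη, hηε⟩ := ENNReal.exists_nnreal_pos_mul_lt
    (measure_ne_top (sphereMeasure (Euc n)) univ) hε3
  filter_upwards [eventually_ae_dist_lt g.continuous (NNReal.coe_pos.2 hη),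
    Ioo_mem_nhdsLT (zero_lt_one' ℝ)] with t ht ht'
  have hs := sqrt_mem ht'
  refine (lintegral_enorm_sliceProb_sub_le (by nlinarith [hs.1, hs.2]) hf hfi g.continuous
    ht).trans ?_
  calc _ ≤ ε / 3 + ε / 3 + ε / 3 := by gcongr
    _ = ε := ENNReal.add_thirds ε

theorem tendsto_eLpNorm_tildeFun_sub {f : UnitSphere (Euc n) → 𝕜}
    (hf : Integrable f (sphereMeasure (Euc n))) :
    Tendsto (fun t : ℝ => eLpNorm (fun x => √t • tildeFun f x t - f x) 1
      (sphereMeasure (Euc n))) (𝓝[<] 1) (𝓝 0) := by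
  obtain ⟨g, hg, hfg⟩ := hf.1
  refine (tendsto_lintegral_sliceProb_sub hg (hf.congr hfg)).congr' ?_
  filter_upwards [Ioo_mem_nhdsLT (zero_lt_one' ℝ)] with t ht
  have hs := sqrt_mem ht
  rw [eLpNorm_one_eq_lintegral_enorm]
  refine lintegral_congr_ae ?_
  filter_upwards [hfg, ae_ae_sliceProb_left (t := √t) (by nlinarith [hs.1, hs.2]) hfg] with x hx hx'
  rw [sqrt_smul_tildeFun f x ht, hx, integral_congr_ae hx']

end Limit

end MinkowskiFunk

end

/-! ### The inversion theorem. -/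

open MinkowskiFunk in
theorem mainTheorem2 (n : ℕ) [Fact (3 ≤ n)] {𝕜 : Type*} [RCLike 𝕜]
    (k : {k : Fin n // k ≠ lastIdx n}) (f : UnitSphere (Euc n) → 𝕜)
    (hf : Integrable f (sphereMeasure (Euc n)))
    (heven : ∀ᵐ x ∂(sphereMeasure (Euc n)), f (-x) = f x) :
    (∀ x : UnitSphere (Euc n),
      (∃ ψ, IsRLPreimage (((n : ℝ) - 2) / 2) 1 (dualFunkProfile k f x) ψ) ∧
      ∀ᵐ t ∂(volume.restrict (Ioo (0 : ℝ) 1)),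
        tildeFun f x t =
          (2 * Real.pi ^ (((n : ℝ) - 2) / 2))⁻¹ •
            rlDeriv (((n : ℝ) - 2) / 2) 1 (dualFunkProfile k f x) t) ∧
    (∀ t ∈ Ioo (0 : ℝ) 1,
      Integrable (fun x => √t • tildeFun f x t) (sphereMeasure (Euc n))) ∧
    Tendsto (fun t : ℝ => eLpNorm (fun x => √t • tildeFun f x t - f x) 1
      (sphereMeasure (Euc n))) (𝓝[<] 1) (𝓝 0) ∧
    (Continuous f →
      TendstoUniformly (fun (t : ℝ) x => √t • tildeFun f x t) f (𝓝[<] 1)) := by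
  refine ⟨fun x => ⟨?_, tildeFun_ae_eq_rlDeriv hf heven k x⟩, fun t ht => ?_,
    tendsto_eLpNorm_tildeFun_sub hf, tendstoUniformly_tildeFun⟩
  · obtain ⟨ψ, hψ, -⟩ := isRLPreimage_dualFunkProfile hf heven k x
    exact ⟨ψ, hψ⟩
  · simp_rw [fun x => sqrt_smul_tildeFun f x ht]
    have hs := sqrt_mem ht
    exact integrable_integral_sliceProb (by nlinarith [hs.1, hs.2]) hf
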